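/- Fix $c_0\in(0,1]$. For $\sigma^2\in(0,\tfrac12]$ let $\mathcal P(\sigma^2)$ be the set of symmetric probability distributions $p$ on $\mathbb Z$ with variance $\sigma^2$ such that $p(1)\ge\tfrac12c_0\sigma^2$ and $\sum_{k\in\mathbb Z}|k|^3p(k)\le c_0^{-1}\sigma^2$. For an integer $L\ge0$ let $\Omega_{0,L}$ be the set of trajectories $\gamma=(\gamma_0,\dots,\gamma_L)\in\mathbb Z^{L+1}$ with $\gamma_0=\gamma_L=0$, let $\Omega^{+,0}_{0,L}$ be the set of those with $\gamma_i\ge0$ for all $i$, and put $w(\gamma)=\prod_{i=1}^Lp(\gamma_i-\gamma_{i-1})$ and $Z_{0,L}=\sum_{\gamma\in\Omega_{0,L}}w(\gamma)$. Let $\mathbb E^{+,0}_{0,L}$ be the expectation with respect to the probability measure on $\Omega^{+,0}_{0,L}$ proportional to $w$. For a sequence $(\varepsilon_j)_{j\ge0}$ of non-negative reals let $$\Phi(\gamma)=\sum_{j=0}^\infty\varepsilon_jN_j(\gamma),\qquad N_j(\gamma)=\sum_{i=1}^{L-1}\mathbf 1(\gamma_i=j),\qquad Z^{\Phi,+,0}_{0,L}=\sum_{\gamma\in\Omega^{+,0}_{0,L}}w(\gamma)e^{\Phi(\gamma)}.$$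 Theorem. There exist constants $a,b,c>0$, depending only on $c_0$, such that for every $\sigma^2\in(0,\tfrac12]$, every $p\in\mathcal P(\sigma^2)$ and every sequence $(\varepsilon_j)_{j\ge0}$ of non-negative reals the following holds. (i) For every integer $d\ge0$ such that $$\frac1{d+1}\sum_{0\le j\le d/2}(j+1)^2\varepsilon_j\ge a\sigma^2,$$ one has $$\mathbb E^{+,0}_{0,L}\big[e^{\Phi}\big]\ge\exp\Big(\frac{c\,\sigma^2L}{(d+1)^2}\Big)$$ for all sufficiently large $L$ (the expectation may be $+\infty$). (ii) If $\sum_{j=0}^\infty(j+1)\varepsilon_j\le b\sigma^2$, then $Z^{\Phi,+,0}_{0,L}\le4\,Z_{0,L}$ for every $L\ge 0$. -/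

import Mathlib

open scoped ENNReal

/-- The class `𝒫(c₀, σ²)` of symmetric step distributions `p` on `ℤ` with variance `s` (standing
for `σ²`), with `p 1 ≥ c₀ σ² / 2` and third absolute moment at most `c₀⁻¹ σ²`.
By symmetry the mean is zero, so the variance is the second moment. -/
structure IsWalkKernel (c₀ s : ℝ) (p : ℤ → ℝ) : Prop where
  nonneg : ∀ k, 0 ≤ p k
  total : HasSum p 1
  symm : ∀ k, p (-k) = p k
  variance : HasSum (fun k : ℤ => (k : ℝ) ^ 2 * p k) s
  step_one : c₀ * s / 2 ≤ p 1
  third_summable : Summable (fun k : ℤ => |(k : ℝ)| ^ 3 * p k)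
  third_le : ∑' k : ℤ, |(k : ℝ)| ^ 3 * p k ≤ c₀⁻¹ * s

/-- `Ω_{0,L}`: trajectories `(γ_0, …, γ_L)` in `ℤ` with `γ_0 = γ_L = 0`. -/
def bridges (L : ℕ) : Set (Fin (L + 1) → ℤ) :=
  {γ | γ 0 = 0 ∧ γ (Fin.last L) = 0}

/-- `Ω⁺_{0,L}`: the trajectories of `Ω_{0,L}` that stay non-negative. -/
def nonnegBridges (L : ℕ) : Set (Fin (L + 1) → ℤ) :=
  {γ | γ ∈ bridges L ∧ ∀ i, 0 ≤ γ i}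

/-- The weight `w(γ) = ∏_{i=1}^{L} p(γ_i - γ_{i-1})`. -/
def pathWeight (p : ℤ → ℝ) {L : ℕ} (γ : Fin (L + 1) → ℤ) : ℝ :=
  ∏ i : Fin L, p (γ i.succ - γ i.castSucc)

/-- The number `N_j(γ)` of visits to `j` at the times `1, …, L - 1`. -/
def visits (j : ℕ) {L : ℕ} (γ : Fin (L + 1) → ℤ) : ℕ :=
  (Finset.univ.filter fun i : Fin (L + 1) => 0 < (i : ℕ) ∧ (i : ℕ) < L ∧ γ i = (j : ℤ)).card

/-- The potential `Φ(γ) = ∑_j ε_j N_j(γ)`; only finitely many terms are non-zero. -/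
noncomputable def pinPotential (ε : ℕ → ℝ) {L : ℕ} (γ : Fin (L + 1) → ℤ) : ℝ :=
  ∑' j : ℕ, ε j * (visits j γ : ℝ)

/-- `Z_{0,L} = ∑_{γ ∈ Ω_{0,L}} w(γ)`. Sums over trajectories are taken in `[0, ∞]`. -/
noncomputable def bridgePartition (p : ℤ → ℝ) (L : ℕ) : ℝ≥0∞ :=
  ∑' γ : bridges L, ENNReal.ofReal (pathWeight p γ.1)

/-- `Z⁺_{0,L} = ∑_{γ ∈ Ω⁺_{0,L}} w(γ)`. -/
noncomputable def nonnegPartition (p : ℤ → ℝ) (L : ℕ) : ℝ≥0∞ :=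
  ∑' γ : nonnegBridges L, ENNReal.ofReal (pathWeight p γ.1)

/-- `Z^{Φ,+}_{0,L} = ∑_{γ ∈ Ω⁺_{0,L}} w(γ) e^{Φ(γ)}`. -/
noncomputable def pinnedPartition (p : ℤ → ℝ) (ε : ℕ → ℝ) (L : ℕ) : ℝ≥0∞ :=
  ∑' γ : nonnegBridges L,
    ENNReal.ofReal (pathWeight p γ.1) * ENNReal.ofReal (Real.exp (pinPotential ε γ.1))

/-- The probability `ℙ⁺_{0,L}(γ) = w(γ) / Z⁺_{0,L}` of a trajectory `γ ∈ Ω⁺_{0,L}`. -/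
noncomputable def nonnegLaw (p : ℤ → ℝ) (L : ℕ) (γ : nonnegBridges L) : ℝ≥0∞ :=
  ENNReal.ofReal (pathWeight p γ.1) / nonnegPartition p L

/-- The expectation `𝔼⁺_{0,L}[F]` of a `[0, ∞]`-valued function `F` of the trajectory. -/
noncomputable def nonnegExpect (p : ℤ → ℝ) (L : ℕ) (F : (Fin (L + 1) → ℤ) → ℝ≥0∞) : ℝ≥0∞ :=
  ∑' γ : nonnegBridges L, nonnegLaw p L γ * F γ.1

/-!
The return weights of the walk are entries of powers of a kernel: with `P⁺` the transition kernel
killed below `0` and `e^ε` the diagonal tilt, `Z^{Φ,+}_{0,L}` is the `(0,0)` entry of `(e^ε P⁺)^L`,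
up to the factor `e^{ε₀}` (`pinnedPartition_succ`). All sums are taken in `[0, ∞]`, where they may
be interchanged freely, and the Dirichlet form of the walk is treated without subtraction through
the identity `2ab + (a - b)² + (b - a)² = a² + b²` for truncated differences.

*Strong pinning.* Since `Z⁺ ≤ 1`, it suffices to bound `Z^{Φ,+}` from below. The kernel
`M = e^{ε/2} P⁺ e^{ε/2}` is symmetric, so the even moments `⟨f, M^{2n} f⟩` are log-convex and
`M^L(0,0)` grows at least like the `L`-th power of any Rayleigh quotient
(`exists_mul_pow_le_kerPow`). If some `ε_j` with `j ≤ d/2` exceeds `4σ²`, the point mass at `j` has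
a large Rayleigh quotient because the walk is lazy, `p(0) ≥ 1 - σ²`. Otherwise one tests with
`e^{-ε/2}` times the tent function on `{0, …, d}`: its Dirichlet energy is at most `σ²(d + 1)`,
which the potential beats, because the tent equals `j + 1` for `j ≤ d/2`.

*Weak pinning.* Three estimates enter, each uniform in the class of walks.
* The heat kernel satisfies `P^n(x,y) ≤ C (1 + c σ² n)^{-1/2}` (`kerPow_stepKer_le`, by the Nash
  inequality), and `Z_{0,n} ≥ c (1 + σ² n)^{-1/2}` (`le_kerPow_stepKer_zero`, by Chebyshev and
  Cauchy–Schwarz).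
* The Green function of the killed walk satisfies `G(x,y) ≤ √((x + 1)(y + 1)) / p(1)`
  (`green_halfKer_sq_le`): the energy of `G(·,y)` is at most `G(y,y)`, and by the Hardy inequality it
  controls `G(x,y)² / (x + 1)`.
* Hence `∑ (j + 1) ε_j ≤ b σ²` makes the potential a small perturbation of the Green function in
  the norm with weight `√(j + 1)` (`sum_green_mul_le`). In the Duhamel expansion of `(e^ε P⁺)^L`
  one of the two factors always runs for at least half of the time and is bounded by the heat
  kernel estimate, while the time sum of the other is a Green function (`kerPow_perturbed_le`).
  So the correction to `Z⁺_{0,L}` is a small multiple of `(1 + σ² L)^{-1/2}`, hence of `Z_{0,L}`.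
-/

/-! ### Powers of kernels and sums over trajectories -/

section KernelPowers

/-- The `n`-th power of the kernel `K` with entries in `[0, ∞]`. -/
noncomputable def kerPow {α : Type*} [DecidableEq α] (K : α → α → ℝ≥0∞) : ℕ → α → α → ℝ≥0∞
  | 0 => fun x y => if x = y then 1 else 0
  | n + 1 => fun x y => ∑' z, kerPow K n x z * K z y

variable {α : Type*} [DecidableEq α] {K K' : α → α → ℝ≥0∞}

theorem tsum_ite_eq_mul (f : α → ℝ≥0∞) (x : α) :
    ∑' z, (if x = z then 1 else 0) * f z = f x := by
  rw [tsum_eq_single x] <;> simp +contextual [eq_comm]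

theorem tsum_mul_ite_eq (f : α → ℝ≥0∞) (x : α) :
    ∑' z, f z * (if z = x then 1 else 0) = f x := by
  rw [tsum_eq_single x] <;> simp +contextual

theorem kerPow_zero (K : α → α → ℝ≥0∞) (x y : α) :
    kerPow K 0 x y = if x = y then 1 else 0 := rfl

theorem kerPow_succ (K : α → α → ℝ≥0∞) (n : ℕ) (x y : α) :
    kerPow K (n + 1) x y = ∑' z, kerPow K n x z * K z y := rfl

theorem kerPow_one (K : α → α → ℝ≥0∞) (x y : α) : kerPow K 1 x y = K x y := by
  rw [kerPow_succ]
  simp only [kerPow_zero, tsum_ite_eq_mul (fun z => K z y)]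

theorem kerPow_add (K : α → α → ℝ≥0∞) (m n : ℕ) (x y : α) :
    kerPow K (m + n) x y = ∑' z, kerPow K m x z * kerPow K n z y := by
  induction n generalizing y with
  | zero => simp only [Nat.add_zero, kerPow_zero, tsum_mul_ite_eq (fun z => kerPow K m x z)]
  | succ n ih =>
    rw [← Nat.add_assoc, kerPow_succ]
    simp only [ih, kerPow_succ K n, ← ENNReal.tsum_mul_left, ← ENNReal.tsum_mul_right]
    rw [ENNReal.tsum_comm]
    simp only [mul_assoc]

theorem kerPow_succ' (K : α → α → ℝ≥0∞) (n : ℕ) (x y : α) :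
    kerPow K (n + 1) x y = ∑' z, K x z * kerPow K n z y := by
  rw [Nat.add_comm, kerPow_add]
  simp only [kerPow_one]

theorem kerPow_mul_le (K : α → α → ℝ≥0∞) (m n : ℕ) (x y z : α) :
    kerPow K m x z * kerPow K n z y ≤ kerPow K (m + n) x y := by
  rw [kerPow_add]
  exact ENNReal.le_tsum z

theorem kerPow_mono (h : ∀ x y, K x y ≤ K' x y) (n : ℕ) (x y : α) :
    kerPow K n x y ≤ kerPow K' n x y := by
  induction n generalizing y with
  | zero => exact le_rfl
  | succ n ih => exact ENNReal.tsum_le_tsum fun z => mul_le_mul' (ih z) (h z y)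

theorem kerPow_comm (h : ∀ x y, K x y = K y x) (n : ℕ) (x y : α) :
    kerPow K n x y = kerPow K n y x := by
  induction n generalizing x y with
  | zero => simp [kerPow_zero, eq_comm]
  | succ n ih =>
    rw [kerPow_succ, kerPow_succ']
    exact tsum_congr fun z => by rw [ih x z, h z y, mul_comm]

theorem tsum_kerPow_eq_one (h : ∀ x, ∑' y, K x y = 1) (n : ℕ) (x : α) :
    ∑' y, kerPow K n x y = 1 := by
  induction n with
  | zero => simp [kerPow_zero]
  | succ n ih =>
    simp only [kerPow_succ]
    rw [ENNReal.tsum_comm]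
    simp only [ENNReal.tsum_mul_left, h, mul_one, ih]

/-- The kernels `r P r` and `r² P` are conjugate by `r`, hence so are their powers; stated without
dividing by `r`. -/
theorem kerPow_conj {r : α → ℝ≥0∞} (P : α → α → ℝ≥0∞) (n : ℕ) (x y : α) :
    r x * kerPow (fun x y => r x * P x y * r y) n x y =
      kerPow (fun x y => r x * r x * P x y) n x y * r y := by
  induction n generalizing y with
  | zero => by_cases h : x = y <;> simp [kerPow_zero, h]
  | succ n ih =>
    rw [kerPow_succ, kerPow_succ, ← ENNReal.tsum_mul_left, ← ENNReal.tsum_mul_right]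
    refine tsum_congr fun z => ?_
    rw [← mul_assoc, ih]
    ring

/-- The entries of `K ^ L` are sums of products over trajectories with fixed endpoints. -/
theorem tsum_path_eq_kerPow (K : α → α → ℝ≥0∞) (L : ℕ) (x y : α) :
    ∑' γ : Fin (L + 1) → α, (if γ 0 = x ∧ γ (Fin.last L) = y then
      ∏ i : Fin L, K (γ i.castSucc) (γ i.succ) else 0) = kerPow K L x y := by
  induction L generalizing y with
  | zero =>
    rw [← (Equiv.funUnique (Fin 1) α).symm.tsum_eq]
    simp only [kerPow_zero]
    rw [tsum_eq_single x]
    · simp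
    · intro z hz
      simp [hz]
  | succ L ih =>
    rw [← (Fin.snocEquiv (fun _ : Fin (L + 2) => α)).tsum_eq, ENNReal.tsum_prod',
      kerPow_succ, tsum_eq_single y]
    · simp only [← ih, ← ENNReal.tsum_mul_right]
      rw [ENNReal.tsum_comm]
      refine tsum_congr fun γ => ?_
      rw [tsum_eq_single (γ (Fin.last L))]
      · have h0 : (Fin.snocEquiv (fun _ : Fin (L + 2) => α)) (y, γ) 0 = γ 0 := by
          have := Fin.snoc_castSucc (α := fun _ : Fin (L + 2) => α) y γ 0
          exact this
        rw [h0]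
        simp [Fin.snocEquiv, Fin.prod_univ_castSucc, ← Fin.castSucc_succ]
      · intro z hz
        simp [Ne.symm hz]
    · intro z hz
      simp [Fin.snocEquiv, hz]

end KernelPowers

/-! ### Dirichlet energy, Hardy and Nash inequalities on the integers -/

section Energy

/-- With truncated subtraction, `(a - b)² + (b - a)²` is the squared distance in `[0, ∞]`. -/
theorem ENNReal.two_mul_add_sq_tsub (a b : ℝ≥0∞) :
    2 * (a * b) + ((a - b) ^ 2 + (b - a) ^ 2) = a ^ 2 + b ^ 2 := by
  wlog h : a ≤ b generalizing a b
  · rw [mul_comm a b, add_comm ((a - b) ^ 2), add_comm (a ^ 2)]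
    exact this b a (le_of_not_ge h)
  obtain ⟨c, hc⟩ : ∃ c, c = b - a := ⟨_, rfl⟩
  have hb : b = a + c := by rw [hc, add_tsub_cancel_of_le h]
  rw [← hc, tsub_eq_zero_of_le h, hb]
  ring

theorem ENNReal.two_mul_le_sq_add_sq (a b : ℝ≥0∞) : 2 * (a * b) ≤ a ^ 2 + b ^ 2 :=
  ENNReal.two_mul_add_sq_tsub a b ▸ le_self_add

theorem ENNReal.sq_tsum_mul_le {α : Type*} (f g : α → ℝ≥0∞) :
    (∑' x, f x * g x) ^ 2 ≤ (∑' x, f x ^ 2) * ∑' x, g x ^ 2 := by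
  have h : 2 * (∑' x, f x * g x) ^ 2 ≤ 2 * ((∑' x, f x ^ 2) * ∑' x, g x ^ 2) := by
    calc 2 * (∑' x, f x * g x) ^ 2
        = ∑' x, ∑' y, 2 * ((f x * g y) * (f y * g x)) := by
          rw [sq]
          simp only [← ENNReal.tsum_mul_left, ← ENNReal.tsum_mul_right]
          refine tsum_congr fun x => tsum_congr fun y => by ring
      _ ≤ ∑' x, ∑' y, ((f x * g y) ^ 2 + (f y * g x) ^ 2) :=
          ENNReal.tsum_le_tsum fun x => ENNReal.tsum_le_tsum fun y =>
            ENNReal.two_mul_le_sq_add_sq _ _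
      _ = 2 * ((∑' x, f x ^ 2) * ∑' x, g x ^ 2) := by
          simp only [ENNReal.tsum_add, mul_pow]
          rw [ENNReal.tsum_comm (f := fun x y => f y ^ 2 * g x ^ 2)]
          simp only [ENNReal.tsum_mul_left, ENNReal.tsum_mul_right]
          ring
  exact (ENNReal.mul_le_mul_iff_right (by simp) (by simp)).1 h

theorem ENNReal.sq_sum_mul_le {α : Type*} (s : Finset α) (f g : α → ℝ≥0∞) :
    (∑ x ∈ s, f x * g x) ^ 2 ≤ (∑ x ∈ s, f x ^ 2) * ∑ x ∈ s, g x ^ 2 := by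
  rw [← Finset.tsum_subtype s (fun x => f x * g x), ← Finset.tsum_subtype s (fun x => f x ^ 2),
    ← Finset.tsum_subtype s (fun x => g x ^ 2)]
  exact ENNReal.sq_tsum_mul_le _ _

/-- The squared `ℓ²` norm of the increments of `g` over `k` steps. -/
noncomputable def incrEnergy (g : ℤ → ℝ≥0∞) (k : ℤ) : ℝ≥0∞ :=
  ∑' x, ((g x - g (x + k)) ^ 2 + (g (x + k) - g x) ^ 2)

/-- The autocorrelation `∑ₓ g(x) g(x + k)`. -/
noncomputable def autocorr (g : ℤ → ℝ≥0∞) (k : ℤ) : ℝ≥0∞ := ∑' x, g x * g (x + k)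

theorem tsum_comp_add_right_int (f : ℤ → ℝ≥0∞) (k : ℤ) : ∑' x, f (x + k) = ∑' x, f x :=
  (Equiv.addRight k).tsum_eq f

theorem two_mul_autocorr_add_incrEnergy (g : ℤ → ℝ≥0∞) (k : ℤ) :
    2 * autocorr g k + incrEnergy g k = 2 * ∑' x, g x ^ 2 := by
  rw [autocorr, incrEnergy, ← ENNReal.tsum_mul_left, ← ENNReal.tsum_add]
  simp only [ENNReal.two_mul_add_sq_tsub, ENNReal.tsum_add]
  rw [tsum_comp_add_right_int (fun x => g x ^ 2), two_mul]

theorem incrEnergy_neg (g : ℤ → ℝ≥0∞) (k : ℤ) : incrEnergy g (-k) = incrEnergy g k := by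
  rw [incrEnergy, ← tsum_comp_add_right_int _ k]
  simp only [add_neg_cancel_right]
  exact tsum_congr fun x => add_comm _ _

theorem autocorr_add_half_incrEnergy (g : ℤ → ℝ≥0∞) (k : ℤ) :
    autocorr g k + 2⁻¹ * incrEnergy g k = ∑' x, g x ^ 2 := by
  have h := congrArg (2⁻¹ * ·) (two_mul_autocorr_add_incrEnergy g k)
  simpa [mul_add, ← mul_assoc, ENNReal.inv_mul_cancel] using h

/-- The quadratic form of the convolution kernel `q`, written by autocorrelations. -/
theorem tsum_quadratic_eq (q g : ℤ → ℝ≥0∞) :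
    ∑' x, ∑' y, g x * q (y - x) * g y = ∑' k, q k * autocorr g k := by
  simp only [autocorr, ← ENNReal.tsum_mul_left]
  rw [ENNReal.tsum_comm (f := fun k x => q k * (g x * g (x + k)))]
  refine tsum_congr fun x => ?_
  rw [← tsum_comp_add_right_int _ x]
  refine tsum_congr fun y => ?_
  rw [add_sub_cancel_right, add_comm y x]
  ring

/-- The Dirichlet form of a symmetric probability kernel dominates that of its nearest-neighbour
part. -/
theorem quadratic_add_energy_le {q : ℤ → ℝ≥0∞} (hq : ∑' k, q k ≤ 1) (hs : q (-1) = q 1)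
    (g : ℤ → ℝ≥0∞) :
    ∑' x, ∑' y, g x * q (y - x) * g y + q 1 * incrEnergy g 1 ≤ ∑' x, g x ^ 2 := by
  have h1 : ∑' k, q k * (2⁻¹ * incrEnergy g k) ≥ q 1 * incrEnergy g 1 := by
    calc ∑' k, q k * (2⁻¹ * incrEnergy g k)
        ≥ ∑ k ∈ ({1, -1} : Finset ℤ), q k * (2⁻¹ * incrEnergy g k) := ENNReal.sum_le_tsum _
      _ = (2⁻¹ + 2⁻¹) * (q 1 * incrEnergy g 1) := by
          rw [Finset.sum_pair (by decide), hs, incrEnergy_neg]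
          ring
      _ = q 1 * incrEnergy g 1 := by rw [ENNReal.inv_two_add_inv_two, one_mul]
  calc _ ≤ ∑' k, q k * autocorr g k + ∑' k, q k * (2⁻¹ * incrEnergy g k) := by
        rw [tsum_quadratic_eq]; gcongr
    _ = (∑' k, q k) * ∑' x, g x ^ 2 := by
        rw [← ENNReal.tsum_add, ← ENNReal.tsum_mul_right]
        simp only [← mul_add, autocorr_add_half_incrEnergy]
    _ ≤ ∑' x, g x ^ 2 := by
        calc _ ≤ 1 * ∑' x, g x ^ 2 := by gcongr
          _ = _ := one_mul _

/-- A one-dimensional Hardy inequality: a function vanishing at `-1` grows at most like the square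
root of the distance. -/
theorem sq_le_mul_incrEnergy {g : ℤ → ℝ≥0∞} (h0 : g (-1) = 0) (n : ℕ) :
    g n ^ 2 ≤ (n + 1) * incrEnergy g 1 := by
  have h1 : ∀ m : ℕ, g ((m : ℤ) - 1) ≤ ∑ i ∈ Finset.range m, (g (i - 1 + 1) - g (i - 1)) := by
    intro m
    induction m with
    | zero => simp [h0]
    | succ m ih =>
      rw [Finset.sum_range_succ]
      have : ((m + 1 : ℕ) : ℤ) - 1 = (m : ℤ) - 1 + 1 := by push_cast; ring
      rw [this]
      exact le_add_tsub.trans (add_le_add_left ih _)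
  have h2 := h1 (n + 1)
  rw [show ((n + 1 : ℕ) : ℤ) - 1 = n by push_cast; ring] at h2
  calc g n ^ 2 ≤ (∑ i ∈ Finset.range (n + 1), 1 * (g (i - 1 + 1) - g ((i : ℤ) - 1))) ^ 2 := by
        simp only [one_mul]; gcongr
    _ ≤ _ := ENNReal.sq_sum_mul_le _ _ _
    _ ≤ (n + 1) * incrEnergy g 1 := by
        gcongr
        · simp
        · have hi : Function.Injective (fun i : ℕ => (i : ℤ) - 1) := fun a b h => by
            simpa using h
          calc _ ≤ ∑' i : ℕ, (g (i - 1 + 1) - g ((i : ℤ) - 1)) ^ 2 := ENNReal.sum_le_tsum _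
            _ ≤ ∑' x : ℤ, (g (x + 1) - g x) ^ 2 :=
              ENNReal.tsum_comp_le_tsum_of_injective hi (fun x => (g (x + 1) - g x) ^ 2)
            _ ≤ incrEnergy g 1 := ENNReal.tsum_le_tsum fun x => le_add_self

/-- An Agmon-type inequality on `ℤ`. -/
theorem pow_four_le_mul_incrEnergy {g : ℤ → ℝ≥0∞} (hg : ∑' x, g x ^ 2 ≠ ∞) (x : ℤ) :
    g x ^ 4 ≤ 4 * (∑' x, g x ^ 2) * incrEnergy g 1 := by
  set S : ℝ≥0∞ := ∑' y, (g y - g (y + 1)) * (g y + g (y + 1)) with hS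
  have hstep : ∀ y, g y ^ 2 ≤ g (y + 1) ^ 2 + (g y - g (y + 1)) * (g y + g (y + 1)) := by
    intro y
    rcases le_total (g y) (g (y + 1)) with h | h
    · exact le_add_right (by gcongr)
    · obtain ⟨c, hc⟩ : ∃ c, c = g y - g (y + 1) := ⟨_, rfl⟩
      have hb : g y = g (y + 1) + c := by rw [hc, add_tsub_cancel_of_le h]
      rw [← hc, hb]
      apply le_of_eq
      ring
  have h1 : ∀ n : ℕ, g x ^ 2 ≤ g (x + n) ^ 2 + ∑ i ∈ Finset.range n,
      (g (x + i) - g (x + i + 1)) * (g (x + i) + g (x + i + 1)) := by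
    intro n
    induction n with
    | zero => simp
    | succ n ih =>
      rw [Finset.sum_range_succ]
      refine ih.trans ((add_le_add_left (hstep (x + n)) _).trans (le_of_eq ?_))
      push_cast
      rw [← add_assoc x]
      ring
  have hi : Function.Injective (fun i : ℕ => x + (i : ℤ)) := fun a b h => by simpa using h
  have h2 : ∀ n : ℕ, g x ^ 2 ≤ g (x + n) ^ 2 + S := fun n =>
    (h1 n).trans (add_le_add_right ((ENNReal.sum_le_tsum _).trans
      (ENNReal.tsum_comp_le_tsum_of_injective hi
        (fun y => (g y - g (y + 1)) * (g y + g (y + 1))))) _)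
  have h3 : Filter.Tendsto (fun n : ℕ => g (x + n) ^ 2 + S) Filter.atTop (nhds (0 + S)) :=
    (ENNReal.tendsto_atTop_zero_of_tsum_ne_top (ne_top_of_le_ne_top hg
      (ENNReal.tsum_comp_le_tsum_of_injective hi (fun y => g y ^ 2)))).add tendsto_const_nhds
  have h4 : g x ^ 2 ≤ S := by simpa using ge_of_tendsto' h3 h2
  calc g x ^ 4 = (g x ^ 2) ^ 2 := by ring
    _ ≤ S ^ 2 := by gcongr
    _ ≤ _ := ENNReal.sq_tsum_mul_le _ _
    _ ≤ incrEnergy g 1 * (4 * ∑' x, g x ^ 2) := by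
        gcongr
        · exact ENNReal.tsum_le_tsum fun x => le_self_add
        · calc ∑' y, (g y + g (y + 1)) ^ 2 ≤ ∑' y, (2 * g y ^ 2 + 2 * g (y + 1) ^ 2) := by
                refine ENNReal.tsum_le_tsum fun y => ?_
                have := ENNReal.two_mul_le_sq_add_sq (g y) (g (y + 1))
                calc (g y + g (y + 1)) ^ 2
                    = g y ^ 2 + g (y + 1) ^ 2 + 2 * (g y * g (y + 1)) := by ring
                  _ ≤ g y ^ 2 + g (y + 1) ^ 2 + (g y ^ 2 + g (y + 1) ^ 2) := by gcongr
                  _ = _ := by ring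
            _ = 4 * ∑' x, g x ^ 2 := by
                rw [ENNReal.tsum_add, ENNReal.tsum_mul_left, ENNReal.tsum_mul_left,
                  tsum_comp_add_right_int (fun y => g y ^ 2)]
                ring
    _ = _ := by ring

/-- The Nash inequality on `ℤ`. -/
theorem nash_inequality {g : ℤ → ℝ≥0∞} (hg : ∑' x, g x ≤ 1) :
    (∑' x, g x ^ 2) ^ 3 ≤ 4 * incrEnergy g 1 := by
  have hle : ∀ x, g x ≤ 1 := fun x => (ENNReal.le_tsum x).trans hg
  have h1 : ∑' x, g x ^ 2 ≤ 1 := by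
    refine le_trans (ENNReal.tsum_le_tsum fun x => ?_) hg
    calc g x ^ 2 = g x * g x := sq _
      _ ≤ g x * 1 := by gcongr; exact hle x
      _ = g x := mul_one _
  have htop : ∑' x, g x ^ 2 ≠ ∞ := ne_top_of_le_ne_top (by simp) h1
  rcases eq_or_ne (∑' x, g x ^ 2) 0 with h0 | h0
  · simp [h0]
  have h2 : ∑' x, g x ^ 2 ≤ ⨆ x, g x := by
    calc ∑' x, g x ^ 2 ≤ ∑' x, g x * ⨆ x, g x := by
          refine ENNReal.tsum_le_tsum fun x => ?_
          rw [sq]; gcongr; exact le_iSup g x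
      _ = (∑' x, g x) * ⨆ x, g x := ENNReal.tsum_mul_right
      _ ≤ 1 * ⨆ x, g x := by gcongr
      _ = _ := one_mul _
  have h3 : (∑' x, g x ^ 2) ^ 4 ≤ 4 * (∑' x, g x ^ 2) * incrEnergy g 1 := by
    calc (∑' x, g x ^ 2) ^ 4 ≤ (⨆ x, g x) ^ 4 := by gcongr
      _ = ⨆ x, g x ^ 4 := by
          exact (ENNReal.iSup_pow g 4)
      _ ≤ _ := iSup_le fun x => pow_four_le_mul_incrEnergy htop x
  rw [← ENNReal.mul_le_mul_iff_right h0 htop]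
  calc _ = (∑' x, g x ^ 2) ^ 4 := by ring
    _ ≤ _ := h3
    _ = _ := by ring

end Energy

/-! ### Heat kernel bounds -/

section HeatKernel

/-- The transition kernel of the random walk on `ℤ` with step weights `q`. -/
def stepKer (q : ℤ → ℝ≥0∞) (x y : ℤ) : ℝ≥0∞ := q (y - x)

variable {q : ℤ → ℝ≥0∞}

theorem stepKer_comm (hs : ∀ k, q (-k) = q k) (x y : ℤ) : stepKer q x y = stepKer q y x := by
  rw [stepKer, stepKer, ← hs, neg_sub]

theorem tsum_stepKer (hq : ∑' k, q k = 1) (x : ℤ) : ∑' y, stepKer q x y = 1 := by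
  rw [← hq, ← tsum_comp_add_right_int q (-x)]
  rfl

/-- One step of the walk lowers the `ℓ²` norm by at least a multiple of the energy. The two-step
kernel is itself a symmetric convolution kernel, and gives a step `1` weight at least `q 1`. -/
theorem tsum_sq_succ_add_energy_le (hq : ∑' k, q k = 1) (hs : ∀ k, q (-k) = q k)
    (h0 : 2⁻¹ ≤ q 0) (u : ℤ → ℝ≥0∞) :
    ∑' y, (∑' z, u z * stepKer q z y) ^ 2 + q 1 * incrEnergy u 1 ≤ ∑' y, u y ^ 2 := by
  set r : ℤ → ℝ≥0∞ := fun k => ∑' j, q j * q (j - k) with hr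
  have hr1 : ∑' k, r k ≤ 1 := by
    rw [hr, ENNReal.tsum_comm]
    simp only [ENNReal.tsum_mul_left]
    have : ∀ j : ℤ, ∑' k, q (j - k) = 1 := fun j => by
      rw [← hq]; exact (Equiv.subLeft j).tsum_eq q
    simp [this, hq]
  have hrs : r (-1) = r 1 := by
    simp only [hr]
    rw [← tsum_comp_add_right_int _ (-1)]
    refine tsum_congr fun j => ?_
    rw [show j + -1 - -1 = j by ring, mul_comm, ← sub_eq_add_neg]
  have hr2 : q 1 ≤ r 1 := by
    calc q 1 = 2⁻¹ * q 1 + 2⁻¹ * q 1 := by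
          rw [← add_mul, ENNReal.inv_two_add_inv_two, one_mul]
      _ ≤ q 0 * q 1 + q 0 * q 1 := by gcongr
      _ = ∑ j ∈ ({0, 1} : Finset ℤ), q j * q (j - 1) := by
          rw [Finset.sum_pair (by decide)]
          simp [hs, mul_comm]
      _ ≤ r 1 := ENNReal.sum_le_tsum _
  have hsq : ∑' y, (∑' z, u z * stepKer q z y) ^ 2 = ∑' x, ∑' y, u x * r (y - x) * u y := by
    calc _ = ∑' y, ∑' z, ∑' w, (u z * stepKer q z y) * (u w * stepKer q w y) := by
          refine tsum_congr fun y => ?_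
          rw [sq, ← ENNReal.tsum_mul_right]
          exact tsum_congr fun z => ENNReal.tsum_mul_left.symm
      _ = ∑' z, ∑' w, ∑' y, (u z * stepKer q z y) * (u w * stepKer q w y) := by
          rw [ENNReal.tsum_comm]
          exact tsum_congr fun z => ENNReal.tsum_comm
      _ = _ := by
          refine tsum_congr fun z => tsum_congr fun w => ?_
          rw [hr, mul_right_comm, ← ENNReal.tsum_mul_left, ← tsum_comp_add_right_int _ z]
          refine tsum_congr fun j => ?_
          simp only [stepKer]
          rw [add_sub_cancel_right, show j + z - w = j - (w - z) by ring]
          ring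
  calc _ ≤ ∑' x, ∑' y, u x * r (y - x) * u y + r 1 * incrEnergy u 1 := by
        rw [hsq]; gcongr
    _ ≤ _ := quadratic_add_energy_le hr1 hrs u

/-- A discrete form of `a' ≤ -ρ a³`: the quantity `a⁻²` grows by at least `2ρ` in every step. -/
theorem sq_mul_le_one_of_cubic_decay {a : ℕ → ℝ} {ρ : ℝ} (ha : ∀ t, 0 ≤ a t) (h0 : a 0 ≤ 1)
    (hρ : 0 ≤ ρ) (h : ∀ t, a (t + 1) + ρ * a t ^ 3 ≤ a t) (t : ℕ) :
    a t ^ 2 * (1 + 2 * ρ * t) ≤ 1 := by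
  induction t with
  | zero =>
    simpa only [Nat.cast_zero, mul_zero, add_zero, mul_one] using
      pow_le_one₀ (n := 2) (ha 0) h0
  | succ t ih =>
    rcases (ha t).eq_or_lt with h1 | h1
    · have h2 := h t
      have h3 := ha (t + 1)
      rw [← h1] at h2
      have : a (t + 1) = 0 := le_antisymm (by simpa using h2) h3
      simp [this]
    · set x := ρ * a t ^ 2 with hx
      have hx0 : 0 ≤ x := by positivity
      have h2 : a (t + 1) ≤ a t * (1 - x) := by
        have := h t
        rw [hx]; linarith [this, show a t * (1 - ρ * a t ^ 2) = a t - ρ * a t ^ 3 by ring]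
      have hx1 : x ≤ 1 := by
        have : 0 ≤ a t * (1 - x) := (ha _).trans h2
        linarith [nonneg_of_mul_nonneg_right this h1]
      have h3 : a (t + 1) ^ 2 ≤ a t ^ 2 * (1 - x) ^ 2 := by
        rw [← mul_pow]; exact pow_le_pow_left₀ (ha _) h2 2
      have h4 : (0 : ℝ) ≤ 1 + 2 * ρ * ((t : ℝ) + 1) := by positivity
      push_cast
      calc a (t + 1) ^ 2 * (1 + 2 * ρ * ((t : ℝ) + 1))
          ≤ a t ^ 2 * (1 - x) ^ 2 * (1 + 2 * ρ * ((t : ℝ) + 1)) := by gcongr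
        _ = (1 - x) ^ 2 * (a t ^ 2 * (1 + 2 * ρ * t) + 2 * x) := by rw [hx]; ring
        _ ≤ (1 - x) ^ 2 * (1 + 2 * x) := by gcongr
        _ ≤ 1 := by nlinarith [mul_nonneg (sq_nonneg x) (sub_nonneg.2 hx1), sq_nonneg x]

theorem tsum_kerPow_sq_le_one (hq : ∑' k, q k = 1) (t : ℕ) (x : ℤ) :
    ∑' y, kerPow (stepKer q) t x y ^ 2 ≤ 1 := by
  have h1 := tsum_kerPow_eq_one (tsum_stepKer hq) t x
  calc ∑' y, kerPow (stepKer q) t x y ^ 2 ≤ ∑' y, kerPow (stepKer q) t x y := by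
        refine ENNReal.tsum_le_tsum fun y => ?_
        rw [sq]
        calc _ ≤ kerPow (stepKer q) t x y * 1 := by
              gcongr; exact h1 ▸ ENNReal.le_tsum y
          _ = _ := mul_one _
    _ = 1 := h1

/-- The `ℓ²` decay of the heat kernel, from the Nash inequality. -/
theorem tsum_kerPow_sq_le (hq : ∑' k, q k = 1) (hs : ∀ k, q (-k) = q k)
    (h0 : 2⁻¹ ≤ q 0) {ρ : ℝ} (hρ : 0 ≤ ρ) (h1 : ENNReal.ofReal (4 * ρ) ≤ q 1) (t : ℕ) (x : ℤ) :
    ∑' y, kerPow (stepKer q) t x y ^ 2 ≤ ENNReal.ofReal (√(1 + 2 * ρ * t))⁻¹ := by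
  set a : ℕ → ℝ≥0∞ := fun t => ∑' y, kerPow (stepKer q) t x y ^ 2 with ha
  have hle : ∀ t, a t ≤ 1 := fun t => tsum_kerPow_sq_le_one hq t x
  have htop : ∀ t, a t ≠ ∞ := fun t => ne_top_of_le_ne_top (by simp) (hle t)
  have hdec : ∀ t, a (t + 1) + ENNReal.ofReal ρ * a t ^ 3 ≤ a t := by
    intro t
    calc a (t + 1) + ENNReal.ofReal ρ * a t ^ 3
        ≤ a (t + 1) + ENNReal.ofReal ρ * (4 * incrEnergy (kerPow (stepKer q) t x) 1) := by
          gcongr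
          exact nash_inequality (tsum_kerPow_eq_one (tsum_stepKer hq) t x).le
      _ = a (t + 1) + ENNReal.ofReal (4 * ρ) * incrEnergy (kerPow (stepKer q) t x) 1 := by
          rw [ENNReal.ofReal_mul (by norm_num)]
          simp only [ENNReal.ofReal_ofNat]
          ring
      _ ≤ a (t + 1) + q 1 * incrEnergy (kerPow (stepKer q) t x) 1 := by gcongr
      _ ≤ a t := tsum_sq_succ_add_energy_le hq hs h0 _
  have hreal := sq_mul_le_one_of_cubic_decay (a := fun t => (a t).toReal) (ρ := ρ)
    (fun t => ENNReal.toReal_nonneg) (by simpa using ENNReal.toReal_mono (by simp) (hle 0)) hρ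
    (fun t => by
      have h2 := ENNReal.toReal_mono (htop t) (hdec t)
      rwa [ENNReal.toReal_add (htop _) (ENNReal.mul_ne_top (by simp) (by simp [htop])),
        ENNReal.toReal_mul, ENNReal.toReal_ofReal hρ, ENNReal.toReal_pow] at h2) t
  have hpos : (0 : ℝ) < 1 + 2 * ρ * t := by positivity
  refine (ENNReal.le_ofReal_iff_toReal_le (htop t) (by positivity)).2 ?_
  rw [← Real.sqrt_inv]
  refine Real.le_sqrt_of_sq_le ?_
  rw [← one_div, le_div_iff₀ hpos]
  exact hreal

/-- The uniform on- and off-diagonal heat kernel bound. -/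
theorem kerPow_stepKer_le (hq : ∑' k, q k = 1) (hs : ∀ k, q (-k) = q k)
    (h0 : 2⁻¹ ≤ q 0) {ρ : ℝ} (hρ : 0 ≤ ρ) (hρ' : ρ ≤ 1 / 2)
    (h1 : ENNReal.ofReal (4 * ρ) ≤ q 1) (n : ℕ) (x y : ℤ) :
    kerPow (stepKer q) n x y ≤ ENNReal.ofReal (√2 / √(1 + ρ * n)) := by
  -- At even times by Cauchy–Schwarz at the midpoint; one more step only averages.
  have heven : ∀ t x y, kerPow (stepKer q) (t + t) x y ≤
      ENNReal.ofReal (√(1 + 2 * ρ * t))⁻¹ := by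
    intro t x y
    have h2 : kerPow (stepKer q) (t + t) x y ^ 2 ≤ (ENNReal.ofReal (√(1 + 2 * ρ * t))⁻¹) ^ 2 := by
      rw [kerPow_add]
      refine (ENNReal.sq_tsum_mul_le _ _).trans ?_
      rw [sq (ENNReal.ofReal _)]
      gcongr
      · exact tsum_kerPow_sq_le hq hs h0 hρ h1 t x
      · simp only [kerPow_comm (stepKer_comm hs) t _ y]
        exact tsum_kerPow_sq_le hq hs h0 hρ h1 t y
    exact (ENNReal.pow_le_pow_left_iff two_ne_zero).1 h2
  have hsqrt : ∀ t : ℕ, (n : ℝ) ≤ 2 * t + 1 → (√(1 + 2 * ρ * t))⁻¹ ≤ √2 / √(1 + ρ * n) := by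
    intro t ht
    rw [← one_div, div_le_div_iff₀ (by positivity) (by positivity), one_mul,
      ← Real.sqrt_mul (by norm_num)]
    refine Real.sqrt_le_sqrt ?_
    nlinarith [mul_le_mul_of_nonneg_left ht hρ, mul_nonneg hρ (Nat.cast_nonneg (α := ℝ) t)]
  obtain ⟨t, ht | ht⟩ := Nat.even_or_odd' n
  · rw [show n = t + t by omega]
    refine (heven t x y).trans (ENNReal.ofReal_le_ofReal ?_)
    rw [show t + t = n by omega]
    exact hsqrt t (by rw [ht]; push_cast; linarith)
  · rw [show n = t + t + 1 by omega, kerPow_succ']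
    calc ∑' z, stepKer q x z * kerPow (stepKer q) (t + t) z y
        ≤ ∑' z, stepKer q x z * ENNReal.ofReal (√(1 + 2 * ρ * t))⁻¹ :=
          ENNReal.tsum_le_tsum fun z => by gcongr; exact heven t z y
      _ = ENNReal.ofReal (√(1 + 2 * ρ * t))⁻¹ := by
          rw [ENNReal.tsum_mul_right, tsum_stepKer hq, one_mul]
      _ ≤ _ := by
          refine ENNReal.ofReal_le_ofReal ?_
          rw [show t + t + 1 = n by omega]
          exact hsqrt t (by rw [ht]; push_cast; linarith)

theorem natAbs_sq_add_add_sub (z k : ℤ) :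
    ((z + k).natAbs : ℝ≥0∞) ^ 2 + ((z - k).natAbs : ℝ≥0∞) ^ 2 =
      2 * (z.natAbs : ℝ≥0∞) ^ 2 + 2 * (k.natAbs : ℝ≥0∞) ^ 2 := by
  have : (z + k).natAbs ^ 2 + (z - k).natAbs ^ 2 = 2 * z.natAbs ^ 2 + 2 * k.natAbs ^ 2 := by
    zify
    simp only [sq_abs]
    ring
  exact_mod_cast this

/-- The variance of the walk grows linearly in time. -/
theorem tsum_natAbs_sq_mul_kerPow (hq : ∑' k, q k = 1) (hs : ∀ k, q (-k) = q k) (t : ℕ) :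
    ∑' y : ℤ, (y.natAbs : ℝ≥0∞) ^ 2 * kerPow (stepKer q) t 0 y =
      t * ∑' k : ℤ, (k.natAbs : ℝ≥0∞) ^ 2 * q k := by
  set v := ∑' k : ℤ, (k.natAbs : ℝ≥0∞) ^ 2 * q k with hv
  have hstep : ∀ z : ℤ, ∑' y : ℤ, (y.natAbs : ℝ≥0∞) ^ 2 * stepKer q z y =
      (z.natAbs : ℝ≥0∞) ^ 2 + v := by
    intro z
    have e1 : ∑' y : ℤ, (y.natAbs : ℝ≥0∞) ^ 2 * stepKer q z y =
        ∑' k : ℤ, ((z + k).natAbs : ℝ≥0∞) ^ 2 * q k := by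
      rw [← tsum_comp_add_right_int _ z]
      refine tsum_congr fun k => ?_
      rw [stepKer, add_sub_cancel_right, add_comm k]
    have e2 : ∑' k : ℤ, ((z + k).natAbs : ℝ≥0∞) ^ 2 * q k =
        ∑' k : ℤ, ((z - k).natAbs : ℝ≥0∞) ^ 2 * q k := by
      rw [← (Equiv.neg ℤ).tsum_eq]
      refine tsum_congr fun k => ?_
      simp [hs, sub_eq_add_neg]
    have e3 : 2 * ∑' k : ℤ, ((z + k).natAbs : ℝ≥0∞) ^ 2 * q k =
        2 * ((z.natAbs : ℝ≥0∞) ^ 2 + v) := by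
      calc _ = ∑' k : ℤ, ((z + k).natAbs : ℝ≥0∞) ^ 2 * q k +
            ∑' k : ℤ, ((z - k).natAbs : ℝ≥0∞) ^ 2 * q k := by rw [← e2, two_mul]
        _ = _ := by
          rw [← ENNReal.tsum_add]
          simp only [← add_mul, natAbs_sq_add_add_sub]
          simp only [add_mul, ENNReal.tsum_add, mul_assoc, ENNReal.tsum_mul_left, hq, mul_one,
            ← hv]
          ring
    rw [e1]
    exact (ENNReal.mul_right_inj (by simp) (by simp)).1 e3
  induction t with
  | zero =>
    simp only [kerPow_zero, Nat.cast_zero, zero_mul]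
    refine ENNReal.tsum_eq_zero.2 fun y => ?_
    by_cases h : 0 = y
    · simp [← h]
    · simp [h]
  | succ t ih =>
    simp only [kerPow_succ, ← ENNReal.tsum_mul_left]
    rw [ENNReal.tsum_comm]
    calc _ = ∑' z, kerPow (stepKer q) t 0 z *
          ∑' y : ℤ, (y.natAbs : ℝ≥0∞) ^ 2 * stepKer q z y := by
          refine tsum_congr fun z => ?_
          rw [← ENNReal.tsum_mul_left]
          exact tsum_congr fun y => mul_left_comm _ _ _
      _ = ∑' z : ℤ, ((z.natAbs : ℝ≥0∞) ^ 2 * kerPow (stepKer q) t 0 z +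
          kerPow (stepKer q) t 0 z * v) := by
          refine tsum_congr fun z => ?_
          rw [hstep]; ring
      _ = _ := by
          rw [ENNReal.tsum_add, ih, ENNReal.tsum_mul_right,
            tsum_kerPow_eq_one (tsum_stepKer hq), Nat.cast_succ]
          ring

/-- The on-diagonal lower bound: by Chebyshev the walk at time `t` lives on a window of width of
order `√(st)`, and Cauchy–Schwarz on that window bounds `∑ P^t(0,y)²` from below. -/
theorem le_tsum_kerPow_sq (hq : ∑' k, q k = 1) (hs : ∀ k, q (-k) = q k) {s : ℝ} (hs0 : 0 ≤ s)
    (hv : ∑' k : ℤ, (k.natAbs : ℝ≥0∞) ^ 2 * q k ≤ ENNReal.ofReal s) (t : ℕ) :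
    ENNReal.ofReal (9 / 16 / (4 * √(s * t) + 3)) ≤ ∑' y, kerPow (stepKer q) t 0 y ^ 2 := by
  set u := kerPow (stepKer q) t 0 with hu
  -- The standard deviation is at most half of `R`, so the window `[-R, R]` carries mass `≥ 3/4`.
  set R : ℕ := ⌊2 * √(s * t)⌋₊ + 1 with hR
  have hR1 : 2 * √(s * t) ≤ R := by
    rw [hR]; push_cast; exact (Nat.lt_floor_add_one _).le
  have hR2 : (R : ℝ) ≤ 2 * √(s * t) + 1 := by
    rw [hR]; push_cast
    linarith [Nat.floor_le (show 0 ≤ 2 * √(s * t) by positivity)]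
  have hR0 : (0 : ℝ) < R := by rw [hR]; positivity
  have hst : s * t ≤ (R : ℝ) ^ 2 / 4 := by
    have := pow_le_pow_left₀ (by positivity) hR1 2
    rw [mul_pow, Real.sq_sqrt (by positivity)] at this
    linarith
  set B : Finset ℤ := Finset.Icc (-(R : ℤ)) R with hB
  set σ := ∑ y ∈ B, u y with hσ
  have hu1 : ∑' y, u y = 1 := tsum_kerPow_eq_one (tsum_stepKer hq) t 0
  have hσ1 : σ ≤ 1 := hu1 ▸ ENNReal.sum_le_tsum _
  have hσt : σ ≠ ∞ := ne_top_of_le_ne_top (by simp) hσ1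
  have hcheb : (R : ℝ≥0∞) ^ 2 ≤ (R : ℝ≥0∞) ^ 2 * σ + ENNReal.ofReal (s * t) := by
    calc (R : ℝ≥0∞) ^ 2 = ∑' y, (R : ℝ≥0∞) ^ 2 * u y := by rw [ENNReal.tsum_mul_left, hu1, mul_one]
      _ ≤ ∑' y : ℤ, ((if y ∈ B then (R : ℝ≥0∞) ^ 2 * u y else 0) +
          (y.natAbs : ℝ≥0∞) ^ 2 * u y) := by
          refine ENNReal.tsum_le_tsum fun y => ?_
          by_cases hy : y ∈ B
          · simp [hy]
          · simp only [hy, if_false, zero_add]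
            have : R ≤ y.natAbs := by
              rw [hB, Finset.mem_Icc] at hy
              omega
            gcongr
      _ = (R : ℝ≥0∞) ^ 2 * σ + t * ∑' k : ℤ, (k.natAbs : ℝ≥0∞) ^ 2 * q k := by
          rw [ENNReal.tsum_add, tsum_natAbs_sq_mul_kerPow hq hs, hσ, Finset.mul_sum,
            tsum_eq_sum (s := B) (fun y hy => by simp [hy])]
          congr 1
          exact Finset.sum_congr rfl fun y hy => by simp [hy]
      _ ≤ _ := by
          rw [ENNReal.ofReal_mul hs0, ENNReal.ofReal_natCast, mul_comm (ENNReal.ofReal s)]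
          gcongr
  have hσ2 : 3 / 4 ≤ σ.toReal := by
    have h := ENNReal.toReal_mono (by simp [ENNReal.mul_eq_top, hσt]) hcheb
    rw [ENNReal.toReal_add (by simp [ENNReal.mul_eq_top, hσt]) (by simp), ENNReal.toReal_mul,
      ENNReal.toReal_ofReal (by positivity)] at h
    simp only [ENNReal.toReal_pow, ENNReal.toReal_natCast] at h
    have h2 : (R : ℝ) ^ 2 * (3 / 4) ≤ (R : ℝ) ^ 2 * σ.toReal := by linarith
    exact le_of_mul_le_mul_left h2 (by positivity)
  have hcs : σ ^ 2 ≤ (2 * R + 1) * ∑' y, u y ^ 2 := by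
    calc σ ^ 2 = (∑ y ∈ B, 1 * u y) ^ 2 := by simp [hσ]
      _ ≤ (∑ y ∈ B, 1 ^ 2) * ∑ y ∈ B, u y ^ 2 := ENNReal.sq_sum_mul_le _ _ _
      _ ≤ _ := by
          gcongr
          · rw [hB]
            simp only [one_pow, Finset.sum_const, Int.card_Icc, nsmul_eq_mul, mul_one]
            rw [show ((R : ℤ) + 1 - -(R : ℤ)).toNat = 2 * R + 1 by omega]
            push_cast
            exact le_rfl
          · exact ENNReal.sum_le_tsum _
  have htop : ∑' y, u y ^ 2 ≠ ∞ :=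
    ne_top_of_le_ne_top (by simp) (tsum_kerPow_sq_le_one hq t 0)
  have hcs' : σ.toReal ^ 2 ≤ (2 * R + 1) * (∑' y, u y ^ 2).toReal := by
    have h := ENNReal.toReal_mono (ENNReal.mul_ne_top (by finiteness) htop) hcs
    rw [ENNReal.toReal_mul, ENNReal.toReal_pow, ENNReal.toReal_add (by finiteness) (by simp)] at h
    simpa using h
  rw [ENNReal.ofReal_le_iff_le_toReal htop, div_le_iff₀ (by positivity)]
  have h0 : 0 ≤ (∑' y, u y ^ 2).toReal := ENNReal.toReal_nonneg
  nlinarith [mul_le_mul_of_nonneg_right (show 2 * (R : ℝ) + 1 ≤ 4 * √(s * t) + 3 by linarith) h0]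

/-- The return probability is at least of order `(1 + sn)^(-1/2)`. -/
theorem le_kerPow_stepKer_zero (hq : ∑' k, q k = 1) (hs : ∀ k, q (-k) = q k) (h0 : 2⁻¹ ≤ q 0)
    {s : ℝ} (hs0 : 0 ≤ s)
    (hv : ∑' k : ℤ, (k.natAbs : ℝ≥0∞) ^ 2 * q k ≤ ENNReal.ofReal s) (n : ℕ) :
    ENNReal.ofReal (1 / 25 / √(1 + s * n)) ≤ kerPow (stepKer q) n 0 0 := by
  have heven : ∀ t : ℕ, ENNReal.ofReal (9 / 16 / (4 * √(s * t) + 3)) ≤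
      kerPow (stepKer q) (t + t) 0 0 := by
    intro t
    rw [kerPow_add]
    refine (le_tsum_kerPow_sq hq hs hs0 hv t).trans (le_of_eq (tsum_congr fun y => ?_))
    rw [kerPow_comm (stepKer_comm hs) t y 0, sq]
  have hreal : ∀ t : ℕ, t ≤ n → 1 / 25 / √(1 + s * n) ≤ 2⁻¹ * (9 / 16 / (4 * √(s * t) + 3)) := by
    intro t ht
    have h1 : √(s * t) ≤ √(1 + s * n) := by
      refine Real.sqrt_le_sqrt ?_
      have : (t : ℝ) ≤ n := by exact_mod_cast ht
      nlinarith
    have h2 : 1 ≤ √(1 + s * n) := Real.one_le_sqrt.2 (by nlinarith [mul_nonneg hs0 n.cast_nonneg])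
    rw [← mul_div_assoc, div_le_div_iff₀ (by positivity) (by positivity)]
    nlinarith
  -- At odd times the walk is asked to stay put in the last step.
  obtain ⟨t, ht | ht⟩ := Nat.even_or_odd' n
  · rw [show n = t + t by omega]
    refine le_trans (ENNReal.ofReal_le_ofReal ?_) (heven t)
    rw [show t + t = n by omega]
    refine (hreal t (by omega)).trans ?_
    have : 0 ≤ 9 / 16 / (4 * √(s * t) + 3) := by positivity
    linarith
  · rw [show n = t + t + 1 by omega]
    refine le_trans ?_ (kerPow_mul_le (stepKer q) (t + t) 1 0 0 0)
    rw [kerPow_one, mul_comm (kerPow _ _ _ _)]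
    calc ENNReal.ofReal (1 / 25 / √(1 + s * ↑(t + t + 1)))
        ≤ ENNReal.ofReal (2⁻¹ * (9 / 16 / (4 * √(s * t) + 3))) := by
          rw [show t + t + 1 = n by omega]
          exact ENNReal.ofReal_le_ofReal (hreal t (by omega))
      _ = 2⁻¹ * ENNReal.ofReal (9 / 16 / (4 * √(s * t) + 3)) := by
          rw [ENNReal.ofReal_mul (by norm_num), ENNReal.ofReal_inv_of_pos (by norm_num)]
          simp
      _ ≤ stepKer q 0 0 * kerPow (stepKer q) (t + t) 0 0 := by
          gcongr
          · simpa [stepKer] using h0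
          · exact heven t

end HeatKernel

/-! ### The Green function of the killed walk -/

section Green

/-- The transition kernel of the walk with step weights `q`, killed when it leaves the
non-negative integers. -/
def halfKer (q : ℤ → ℝ≥0∞) (x y : ℕ) : ℝ≥0∞ := q ((y : ℤ) - x)

variable {q : ℤ → ℝ≥0∞}

theorem halfKer_comm (hs : ∀ k, q (-k) = q k) (x y : ℕ) : halfKer q x y = halfKer q y x := by
  rw [halfKer, halfKer, ← hs, neg_sub]

theorem kerPow_halfKer_le (q : ℤ → ℝ≥0∞) (n : ℕ) (x y : ℕ) :
    kerPow (halfKer q) n x y ≤ kerPow (stepKer q) n x y := by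
  induction n generalizing y with
  | zero => simp [kerPow_zero]
  | succ n ih =>
    calc kerPow (halfKer q) (n + 1) x y
        ≤ ∑' z : ℕ, kerPow (stepKer q) n x (z : ℤ) * stepKer q (z : ℤ) y :=
          ENNReal.tsum_le_tsum fun z => by gcongr; exacts [ih z, le_rfl]
      _ ≤ _ := ENNReal.tsum_comp_le_tsum_of_injective Nat.cast_injective
          (fun z : ℤ => kerPow (stepKer q) n x z * stepKer q z y)

theorem tsum_kerPow_halfKer_le (hq : ∑' k, q k = 1) (n : ℕ) (x : ℕ) :
    ∑' y, kerPow (halfKer q) n x y ≤ 1 := by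
  calc ∑' y, kerPow (halfKer q) n x y ≤ ∑' y : ℕ, kerPow (stepKer q) n x (y : ℤ) :=
        ENNReal.tsum_le_tsum fun y => kerPow_halfKer_le q n x y
    _ ≤ ∑' y : ℤ, kerPow (stepKer q) n x y :=
        ENNReal.tsum_comp_le_tsum_of_injective Nat.cast_injective _
    _ = 1 := tsum_kerPow_eq_one (tsum_stepKer hq) n x

/-- Extension by zero of a function on `ℕ` to `ℤ`. -/
def extendZero (G : ℕ → ℝ≥0∞) (z : ℤ) : ℝ≥0∞ := if 0 ≤ z then G z.toNat else 0

@[simp] theorem extendZero_natCast (G : ℕ → ℝ≥0∞) (n : ℕ) : extendZero G n = G n := by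
  simp [extendZero]

theorem extendZero_of_neg (G : ℕ → ℝ≥0∞) {z : ℤ} (hz : z < 0) : extendZero G z = 0 := by
  simp [extendZero, hz]

theorem tsum_int_eq_tsum_nat {f : ℤ → ℝ≥0∞} (hf : ∀ z < 0, f z = 0) :
    ∑' z, f z = ∑' n : ℕ, f n := by
  refine (Function.Injective.tsum_eq Nat.cast_injective ?_).symm
  intro z hz
  rcases lt_or_ge z 0 with h | h
  · exact absurd (hf z h) hz
  · exact ⟨z.toNat, Int.toNat_of_nonneg h⟩

theorem tsum_extendZero_quadratic (q : ℤ → ℝ≥0∞) (G : ℕ → ℝ≥0∞) :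
    ∑' x, ∑' y, extendZero G x * q (y - x) * extendZero G y =
      ∑' x : ℕ, ∑' y : ℕ, G x * halfKer q x y * G y := by
  rw [tsum_int_eq_tsum_nat fun z hz => by simp [extendZero_of_neg G hz]]
  refine tsum_congr fun x => ?_
  rw [tsum_int_eq_tsum_nat fun z hz => by simp [extendZero_of_neg G hz]]
  simp [halfKer]

/-- The truncated Green function of the killed walk. The energy of `G = G_T(·, y)` is at most
`G(y)`, while the Hardy inequality bounds `G(x)²` by `x + 1` times the energy; the case `x = y`
bounds `G(y)` itself. -/
theorem green_halfKer_sq_le (hq : ∑' k, q k = 1) (hs : ∀ k, q (-k) = q k) (T x y : ℕ) :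
    ((∑ t ∈ Finset.range T, kerPow (halfKer q) t x y) * q 1) ^ 2 ≤ (x + 1) * (y + 1) := by
  set G : ℕ → ℝ≥0∞ := fun x => ∑ t ∈ Finset.range T, kerPow (halfKer q) t x y with hG
  set g := extendZero G with hg
  have hGs : ∑' x, G x ≤ T := by
    calc ∑' x, G x = ∑ t ∈ Finset.range T, ∑' x, kerPow (halfKer q) t x y := by
          rw [hG, Summable.tsum_finsetSum fun _ _ => ENNReal.summable]
      _ ≤ ∑ t ∈ Finset.range T, 1 := by
          refine Finset.sum_le_sum fun t _ => ?_
          simp only [kerPow_comm (halfKer_comm hs) t _ y]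
          exact tsum_kerPow_halfKer_le hq t y
      _ = T := by simp
  have hGT : ∀ x, G x ≤ T := fun x => (ENNReal.le_tsum x).trans hGs
  have hstep : ∀ x, G x ≤ ∑' z, halfKer q x z * G z + if x = y then 1 else 0 := by
    intro x
    calc G x ≤ ∑ t ∈ Finset.range (T + 1), kerPow (halfKer q) t x y := by
          rw [Finset.sum_range_succ]; exact le_self_add
      _ = _ := by
          rw [Finset.sum_range_succ', kerPow_zero]
          congr 1
          simp only [kerPow_succ', hG, Finset.mul_sum]
          rw [Summable.tsum_finsetSum fun _ _ => ENNReal.summable]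
  have hsq : ∑' z, g z ^ 2 ≤ ∑' x, ∑' y, g x * q (y - x) * g y + G y := by
    rw [tsum_extendZero_quadratic, tsum_int_eq_tsum_nat fun z hz => by
      simp [hg, extendZero_of_neg G hz]]
    calc ∑' n : ℕ, g n ^ 2 = ∑' n : ℕ, G n * G n := by simp [hg, sq]
      _ ≤ ∑' n : ℕ, G n * (∑' z, halfKer q n z * G z + if n = y then 1 else 0) :=
          ENNReal.tsum_le_tsum fun n => by gcongr; exact hstep n
      _ = _ := by
          simp only [mul_add, ENNReal.tsum_add, tsum_mul_ite_eq, mul_assoc,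
            ENNReal.tsum_mul_left]
  have hfin : ∑' x, ∑' y, g x * q (y - x) * g y ≠ ∞ := by
    have h1 : ∑' z, g z ^ 2 ≠ ∞ := by
      rw [tsum_int_eq_tsum_nat fun z hz => by simp [hg, extendZero_of_neg G hz]]
      refine ne_top_of_le_ne_top (b := (T : ℝ≥0∞) * T) (by finiteness) ?_
      calc ∑' n : ℕ, g n ^ 2 = ∑' n : ℕ, G n * G n := by simp [hg, sq]
        _ ≤ ∑' n : ℕ, T * G n := ENNReal.tsum_le_tsum fun n => by gcongr; exact hGT n
        _ ≤ T * T := by rw [ENNReal.tsum_mul_left]; gcongr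
    exact ne_top_of_le_ne_top h1
      (le_self_add.trans (quadratic_add_energy_le hq.le (hs 1) g))
  have hen : q 1 * incrEnergy g 1 ≤ G y :=
    (ENNReal.add_le_add_iff_left hfin).1
      ((quadratic_add_energy_le hq.le (hs 1) g).trans hsq)
  have hardy : ∀ x : ℕ, q 1 * G x ^ 2 ≤ (x + 1) * G y := by
    intro x
    have h0 : g (-1) = 0 := extendZero_of_neg G (by norm_num)
    calc q 1 * G x ^ 2 = q 1 * g x ^ 2 := by simp [hg]
      _ ≤ q 1 * ((x + 1) * incrEnergy g 1) := by gcongr; exact sq_le_mul_incrEnergy h0 x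
      _ = (x + 1) * (q 1 * incrEnergy g 1) := by ring
      _ ≤ _ := by gcongr
  have hdiag : q 1 * G y ≤ y + 1 := by
    rcases eq_or_ne (G y) 0 with h | h
    · simp [h]
    · refine (ENNReal.mul_le_mul_iff_left h
        (ne_top_of_le_ne_top (ENNReal.natCast_ne_top T) (hGT y))).1 ?_
      calc q 1 * G y * G y = q 1 * G y ^ 2 := by ring
        _ ≤ _ := hardy y
  calc (G x * q 1) ^ 2 = q 1 * (q 1 * G x ^ 2) := by ring
    _ ≤ q 1 * ((x + 1) * G y) := mul_le_mul' le_rfl (hardy x)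
    _ = (x + 1) * (q 1 * G y) := by ring
    _ ≤ _ := by gcongr

end Green

/-! ### Perturbation of a kernel by a small potential -/

section Perturbation

variable {α : Type*} [DecidableEq α]

theorem sum_comp_le_sum_range {φ : ℕ → ℕ} {S : Finset ℕ} {N : ℕ} (hφ : Set.InjOn φ S)
    (hm : ∀ t ∈ S, φ t < N) (f : ℕ → ℝ≥0∞) :
    ∑ t ∈ S, f (φ t) ≤ ∑ m ∈ Finset.range N, f m := by
  rw [← Finset.sum_image (f := f) hφ]
  refine Finset.sum_le_sum_of_subset fun m hm' => ?_
  obtain ⟨t, ht, rfl⟩ := Finset.mem_image.1 hm'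
  exact Finset.mem_range.2 (hm t ht)

/-- Duhamel expansion with respect to the time of the last use of the perturbation `η`. -/
theorem kerPow_duhamel (P : α → α → ℝ≥0∞) (η : α → ℝ≥0∞) (L : ℕ) (x y : α) :
    kerPow (fun x y => (1 + η x) * P x y) L x y = kerPow P L x y +
      ∑ t ∈ Finset.range L, ∑' z,
        kerPow (fun x y => (1 + η x) * P x y) t x z * η z * kerPow P (L - t) z y := by
  set K : α → α → ℝ≥0∞ := fun x y => (1 + η x) * P x y with hK
  induction L generalizing y with
  | zero => simp [kerPow_zero]
  | succ L ih =>
    have h1 : kerPow K (L + 1) x y =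
        ∑' z, kerPow K L x z * P z y + ∑' z, kerPow K L x z * η z * kerPow P 1 z y := by
      rw [kerPow_succ, ← ENNReal.tsum_add]
      refine tsum_congr fun z => ?_
      rw [kerPow_one, hK]
      ring
    rw [h1, Finset.sum_range_succ, Nat.add_sub_cancel_left, ← add_assoc]
    congr 1
    simp only [ih, add_mul, ENNReal.tsum_add, Finset.sum_mul]
    rw [← kerPow_succ]
    congr 1
    rw [Summable.tsum_finsetSum fun _ _ => ENNReal.summable]
    refine Finset.sum_congr rfl fun t ht => ?_
    rw [show L + 1 - t = L - t + 1 by have := Finset.mem_range.1 ht; omega]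
    simp only [kerPow_succ, ← ENNReal.tsum_mul_left, ← ENNReal.tsum_mul_right]
    rw [ENNReal.tsum_comm]
    simp only [mul_assoc]

/-- A Khas'minskii bound: if the potential `η` is a small perturbation of the Green function of
`P` in the norm weighted by `w`, the same holds for the perturbed walk. -/
theorem sum_kerPow_perturbed_le {P : α → α → ℝ≥0∞} {η w : α → ℝ≥0∞} {κ : ℝ≥0∞} (hκ : κ ≤ 8⁻¹)
    (hG : ∀ T x, ∑ t ∈ Finset.range T, ∑' y, kerPow P t x y * η y * w y ≤ κ * w x)
    (T : ℕ) (x : α) :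
    ∑ t ∈ Finset.range T, ∑' y, kerPow (fun x y => (1 + η x) * P x y) t x y * η y * w y ≤
      2 * κ * w x := by
  set K : α → α → ℝ≥0∞ := fun x y => (1 + η x) * P x y with hK
  induction T with
  | zero => simp
  | succ T ih =>
    calc ∑ t ∈ Finset.range (T + 1), ∑' y, kerPow K t x y * η y * w y
        = ∑ t ∈ Finset.range (T + 1), ∑' y, kerPow P t x y * η y * w y +
          ∑ t ∈ Finset.range (T + 1), ∑ r ∈ Finset.range t, ∑' z, kerPow K r x z * η z *
            ∑' y, kerPow P (t - r) z y * η y * w y := by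
          rw [← Finset.sum_add_distrib]
          refine Finset.sum_congr rfl fun t _ => ?_
          have hd := kerPow_duhamel P η t x
          rw [← hK] at hd
          simp only [hd, add_mul, ENNReal.tsum_add, Finset.sum_mul]
          congr 1
          rw [Summable.tsum_finsetSum fun _ _ => ENNReal.summable]
          refine Finset.sum_congr rfl fun r _ => ?_
          simp only [← ENNReal.tsum_mul_left, ← ENNReal.tsum_mul_right]
          rw [ENNReal.tsum_comm]
          simp only [mul_assoc]
      _ ≤ κ * w x + ∑ r ∈ Finset.range T, ∑' z, kerPow K r x z * η z * (κ * w z) := by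
          gcongr
          · exact hG _ _
          rw [Finset.sum_comm' (t' := Finset.range T) (s' := fun r => Finset.Ico (r + 1) (T + 1))
            (by intro a b; simp only [Finset.mem_range, Finset.mem_Ico]; omega)]
          refine Finset.sum_le_sum fun r _ => ?_
          rw [← Summable.tsum_finsetSum fun _ _ => ENNReal.summable]
          refine ENNReal.tsum_le_tsum fun z => ?_
          rw [← Finset.mul_sum]
          gcongr
          refine le_trans ?_ (hG (T + 1) z)
          refine sum_comp_le_sum_range (φ := fun t => t - r) ?_ ?_
            (fun m => ∑' y, kerPow P m z y * η y * w y)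
          · intro a ha b hb h
            simp only [Finset.coe_Ico, Set.mem_Ico] at ha hb h
            omega
          · intro t ht
            have := Finset.mem_Ico.1 ht
            omega
      _ = κ * w x + κ * ∑ r ∈ Finset.range T, ∑' z, kerPow K r x z * η z * w z := by
          congr 1
          rw [Finset.mul_sum]
          refine Finset.sum_congr rfl fun r _ => ?_
          rw [← ENNReal.tsum_mul_left]
          exact tsum_congr fun z => by ring
      _ ≤ κ * w x + κ * (2 * κ * w x) := by gcongr
      _ = (1 + 2 * κ) * (κ * w x) := by ring
      _ ≤ 2 * (κ * w x) := by
          gcongr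
          calc 1 + 2 * κ ≤ 1 + 2 * 8⁻¹ := by gcongr
            _ ≤ 1 + 2 * 2⁻¹ := by gcongr; norm_num
            _ = 2 := by rw [ENNReal.mul_inv_cancel (by simp) (by simp)]; norm_num
      _ = _ := by ring

/-- A perturbation that is small with respect to the Green function changes the heat kernel by a
small multiple of its own bound `β`. In the Duhamel expansion one of the two factors runs for at
least half of the time, and is bounded by `β`; the sum over the time of the other is a Green
function. -/
theorem kerPow_perturbed_le {P : α → α → ℝ≥0∞} {η w : α → ℝ≥0∞} {κ : ℝ≥0∞} {β : ℕ → ℝ≥0∞}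
    (hκ : κ ≤ 8⁻¹) (hP : ∀ x y, P x y = P y x) (hw : ∀ x, 1 ≤ w x)
    (hG : ∀ T x, ∑ t ∈ Finset.range T, ∑' y, kerPow P t x y * η y * w y ≤ κ * w x)
    (hβ : ∀ n x y, kerPow P n x y ≤ β n) (hβ' : ∀ m n, n ≤ 2 * m → β m ≤ 2 * β n)
    {x : α} (hx : w x = 1) (L : ℕ) (y : α) :
    kerPow (fun x y => (1 + η x) * P x y) L x y ≤ kerPow P L x y + 8 * κ * β L * w y := by
  set K : α → α → ℝ≥0∞ := fun x y => (1 + η x) * P x y with hK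
  induction L using Nat.strong_induction_on generalizing y with
  | _ L ih =>
    rw [kerPow_duhamel, ← hK]
    gcongr
    have hκ8 : 8 * κ ≤ 1 := by
      calc 8 * κ ≤ 8 * 8⁻¹ := by gcongr
        _ = 1 := ENNReal.mul_inv_cancel (by simp) (by simp)
    have hV : ∀ t < L, ∀ z, kerPow K t x z ≤ 2 * β t * w z := by
      intro t ht z
      calc kerPow K t x z ≤ kerPow P t x z + 8 * κ * β t * w z := ih t ht z
        _ ≤ β t * w z + 1 * β t * w z := by
            gcongr
            calc kerPow P t x z ≤ β t * 1 := by rw [mul_one]; exact hβ t x z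
              _ ≤ _ := by gcongr; exact hw z
        _ = _ := by ring
    rw [← Finset.sum_filter_add_sum_filter_not _ (fun t => 2 * t ≤ L)]
    have hA : ∑ t ∈ Finset.range L with 2 * t ≤ L,
        ∑' z, kerPow K t x z * η z * kerPow P (L - t) z y ≤ 4 * κ * β L * w y := by
      calc _ ≤ ∑ t ∈ Finset.range L with 2 * t ≤ L,
            ∑' z, 2 * β L * (kerPow K t x z * η z * w z) := by
            refine Finset.sum_le_sum fun t ht => ENNReal.tsum_le_tsum fun z => ?_
            have h2 := (Finset.mem_filter.1 ht).2
            calc kerPow K t x z * η z * kerPow P (L - t) z y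
                ≤ kerPow K t x z * η z * (2 * β L * 1) := by
                  rw [mul_one]
                  gcongr
                  exact (hβ _ _ _).trans (hβ' _ _ (by omega))
              _ ≤ kerPow K t x z * η z * (2 * β L * w z) := by gcongr; exact hw z
              _ = _ := by ring
        _ ≤ ∑ t ∈ Finset.range L, ∑' z, 2 * β L * (kerPow K t x z * η z * w z) :=
            Finset.sum_le_sum_of_subset (Finset.filter_subset _ _)
        _ = 2 * β L * ∑ t ∈ Finset.range L, ∑' z, kerPow K t x z * η z * w z := by
            simp only [ENNReal.tsum_mul_left, Finset.mul_sum]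
        _ ≤ 2 * β L * (2 * κ * w x) := by gcongr; exact sum_kerPow_perturbed_le hκ hG L x
        _ = 4 * κ * β L * 1 := by rw [hx]; ring
        _ ≤ _ := by gcongr; exact hw y
    have hB : ∑ t ∈ Finset.range L with ¬ 2 * t ≤ L,
        ∑' z, kerPow K t x z * η z * kerPow P (L - t) z y ≤ 4 * κ * β L * w y := by
      calc _ ≤ ∑ t ∈ Finset.range L with ¬ 2 * t ≤ L,
            4 * β L * ∑' z, (kerPow P (L - t) y z * η z * w z) := by
            refine Finset.sum_le_sum fun t ht => ?_
            rw [← ENNReal.tsum_mul_left]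
            refine ENNReal.tsum_le_tsum fun z => ?_
            have h1 := Finset.mem_range.1 (Finset.mem_filter.1 ht).1
            have h2 := (Finset.mem_filter.1 ht).2
            calc kerPow K t x z * η z * kerPow P (L - t) z y
                ≤ 2 * (2 * β L) * w z * η z * kerPow P (L - t) z y := by
                  gcongr
                  refine (hV t h1 z).trans ?_
                  gcongr
                  exact hβ' _ _ (by omega)
              _ = _ := by rw [kerPow_comm hP _ z y]; ring
        _ = 4 * β L * ∑ t ∈ Finset.range L with ¬ 2 * t ≤ L,
            ∑' z, (kerPow P (L - t) y z * η z * w z) := by rw [Finset.mul_sum]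
        _ ≤ 4 * β L * (κ * w y) := by
            gcongr
            refine le_trans ?_ (hG (L + 1) y)
            refine sum_comp_le_sum_range (φ := fun t => L - t) ?_ ?_
              (fun m => ∑' z, kerPow P m y z * η z * w z)
            · intro a ha b hb h
              simp only [Finset.coe_filter, Finset.mem_range, Set.mem_ofPred_eq] at ha hb h
              omega
            · intro t _
              omega
        _ = _ := by ring
    calc _ ≤ 4 * κ * β L * w y + 4 * κ * β L * w y := add_le_add hA hB
      _ = _ := by ring

end Perturbation

/-! ### Partition functions as powers of kernels -/

section Trajectories

theorem bridgePartition_eq {p : ℤ → ℝ} (hp : ∀ k, 0 ≤ p k) (L : ℕ) :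
    bridgePartition p L = kerPow (stepKer fun k => ENNReal.ofReal (p k)) L 0 0 := by
  classical
  rw [bridgePartition, tsum_subtype (bridges L) (fun γ => ENNReal.ofReal (pathWeight p γ)),
    ← tsum_path_eq_kerPow]
  refine tsum_congr fun γ => ?_
  rw [Set.indicator_apply]
  refine if_congr Iff.rfl ?_ rfl
  rw [pathWeight, ENNReal.ofReal_prod_of_nonneg fun i _ => hp _]
  rfl

theorem tsum_nonnegBridges_eq (L : ℕ) (F : (Fin (L + 1) → ℤ) → ℝ≥0∞) :
    ∑' γ : nonnegBridges L, F γ.1 = ∑' γ : Fin (L + 1) → ℕ,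
      if γ 0 = 0 ∧ γ (Fin.last L) = 0 then F (fun i => (γ i : ℤ)) else 0 := by
  classical
  rw [tsum_subtype (nonnegBridges L) F]
  have hinj : Function.Injective (fun (γ : Fin (L + 1) → ℕ) (i : Fin (L + 1)) => (γ i : ℤ)) := by
    intro γ γ' h
    funext i
    exact Nat.cast_injective (congrFun h i)
  rw [← hinj.tsum_eq]
  · refine tsum_congr fun γ => ?_
    rw [Set.indicator_apply]
    refine if_congr ?_ rfl rfl
    simp [nonnegBridges, bridges]
  · intro γ hγ
    have h : γ ∈ nonnegBridges L := Set.mem_of_indicator_ne_zero hγ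
    exact ⟨fun i => (γ i).toNat, funext fun i => Int.toNat_of_nonneg (h.2 i)⟩

theorem pinPotential_natCast (ε : ℕ → ℝ) {L : ℕ} (γ : Fin (L + 2) → ℕ) :
    pinPotential ε (fun i => (γ i : ℤ)) = ∑ i : Fin L, ε (γ i.succ.castSucc) := by
  have h1 : ∀ j : ℕ, ε j * (visits j (fun i => (γ i : ℤ)) : ℝ) =
      ∑ i : Fin L, if j = γ i.succ.castSucc then ε j else 0 := by
    intro j
    have : visits j (fun i => (γ i : ℤ)) = ∑ i : Fin L, if j = γ i.succ.castSucc then 1 else 0 := by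
      rw [visits, Finset.card_filter, Fin.sum_univ_succ, Fin.sum_univ_castSucc]
      simp [eq_comm]
    rw [this]
    push_cast
    rw [Finset.mul_sum]
    exact Finset.sum_congr rfl fun i _ => by simp
  rw [pinPotential]
  simp only [h1]
  exact (hasSum_sum fun i _ => by
    have := hasSum_ite_eq (γ i.succ.castSucc) (ε (γ i.succ.castSucc))
    refine this.congr_fun fun j => ?_
    by_cases h : j = γ i.succ.castSucc
    · rw [if_pos h, if_pos h, h]
    · rw [if_neg h, if_neg h]).tsum_eq

/-- The pinned partition function as an entry of a power of the tilted killed kernel, which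
also gives the starting point its weight. -/
theorem pinnedPartition_succ {p : ℤ → ℝ} (hp : ∀ k, 0 ≤ p k) (ε : ℕ → ℝ) (L : ℕ) :
    ENNReal.ofReal (Real.exp (ε 0)) * pinnedPartition p ε (L + 1) =
      kerPow (fun x y => ENNReal.ofReal (Real.exp (ε x)) *
        halfKer (fun k => ENNReal.ofReal (p k)) x y) (L + 1) 0 0 := by
  rw [pinnedPartition, tsum_nonnegBridges_eq (L + 1) fun γ =>
    ENNReal.ofReal (pathWeight p γ) * ENNReal.ofReal (Real.exp (pinPotential ε γ)),
    ← tsum_path_eq_kerPow, ← ENNReal.tsum_mul_left]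
  refine tsum_congr fun γ => ?_
  split_ifs with h
  · rw [Finset.prod_mul_distrib, Fin.prod_univ_succ, pinPotential_natCast, Real.exp_sum,
      pathWeight, ENNReal.ofReal_prod_of_nonneg fun i _ => hp _,
      ENNReal.ofReal_prod_of_nonneg fun i _ => (Real.exp_pos _).le, Fin.castSucc_zero, h.1]
    simp only [halfKer]
    ring
  · simp

theorem pinnedPartition_le {p : ℤ → ℝ} (hp : ∀ k, 0 ≤ p k) {ε : ℕ → ℝ} (h0 : 0 ≤ ε 0) (L : ℕ) :
    pinnedPartition p ε L ≤ kerPow (fun x y => ENNReal.ofReal (Real.exp (ε x)) *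
        halfKer (fun k => ENNReal.ofReal (p k)) x y) L 0 0 := by
  cases L with
  | zero =>
    rw [pinnedPartition, tsum_nonnegBridges_eq 0 fun γ =>
      ENNReal.ofReal (pathWeight p γ) * ENNReal.ofReal (Real.exp (pinPotential ε γ)),
      ← tsum_path_eq_kerPow]
    refine ENNReal.tsum_le_tsum fun γ => ?_
    simp [pathWeight, pinPotential, visits]
  | succ L =>
    rw [← pinnedPartition_succ hp]
    refine le_mul_of_one_le_left' ?_
    rw [ENNReal.one_le_ofReal]
    exact Real.one_le_exp h0

theorem nonnegPartition_le_bridgePartition (p : ℤ → ℝ) (L : ℕ) :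
    nonnegPartition p L ≤ bridgePartition p L :=
  ENNReal.tsum_mono_subtype (fun γ => ENNReal.ofReal (pathWeight p γ)) fun _ h => h.1

end Trajectories

/-! ### Step distributions of the class -/

section StepWeights

variable {c₀ s : ℝ} {p : ℤ → ℝ}

theorem IsWalkKernel.tsum_ofReal (h : IsWalkKernel c₀ s p) :
    ∑' k, ENNReal.ofReal (p k) = 1 := by
  rw [← ENNReal.ofReal_tsum_of_nonneg h.nonneg h.total.summable, h.total.tsum_eq,
    ENNReal.ofReal_one]

theorem IsWalkKernel.tsum_natAbs_sq (h : IsWalkKernel c₀ s p) :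
    ∑' k : ℤ, (k.natAbs : ℝ≥0∞) ^ 2 * ENNReal.ofReal (p k) = ENNReal.ofReal s := by
  rw [← h.variance.tsum_eq, ENNReal.ofReal_tsum_of_nonneg
    (fun k => mul_nonneg (sq_nonneg _) (h.nonneg k)) h.variance.summable]
  refine tsum_congr fun k => ?_
  rw [ENNReal.ofReal_mul (sq_nonneg _), ← sq_abs, ENNReal.ofReal_pow (abs_nonneg _),
    ← Int.cast_abs, Int.abs_eq_natAbs, Int.cast_natCast, ENNReal.ofReal_natCast]

/-- The walk is lazy: since `k² ≥ 1` for `k ≠ 0`, it moves with probability at most its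
variance. -/
theorem IsWalkKernel.one_le_add (h : IsWalkKernel c₀ s p) :
    1 ≤ ENNReal.ofReal (p 0) + ENNReal.ofReal s := by
  calc (1 : ℝ≥0∞) = ∑' k, ENNReal.ofReal (p k) := h.tsum_ofReal.symm
    _ ≤ ∑' k : ℤ, ((if k = 0 then ENNReal.ofReal (p 0) else 0) +
        (k.natAbs : ℝ≥0∞) ^ 2 * ENNReal.ofReal (p k)) := by
        refine ENNReal.tsum_le_tsum fun k => ?_
        by_cases hk : k = 0
        · simp [hk]
        · have : (1 : ℝ≥0∞) ≤ (k.natAbs : ℝ≥0∞) ^ 2 := by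
            have : 1 ≤ k.natAbs := by omega
            exact one_le_pow₀ (by exact_mod_cast this)
          simpa [hk] using le_mul_of_one_le_left' this
    _ = _ := by rw [ENNReal.tsum_add, tsum_ite_eq, h.tsum_natAbs_sq]

theorem IsWalkKernel.one_sub_le (h : IsWalkKernel c₀ s p) (hs : 0 ≤ s) : 1 - s ≤ p 0 := by
  have h1 := h.one_le_add
  rw [← ENNReal.ofReal_add (h.nonneg 0) hs, ENNReal.one_le_ofReal] at h1
  linarith

theorem IsWalkKernel.half_le (h : IsWalkKernel c₀ s p) (hs : 0 ≤ s) (hs' : s ≤ 1 / 2) :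
    2⁻¹ ≤ ENNReal.ofReal (p 0) := by
  rw [← ENNReal.ofReal_ofNat, ← ENNReal.ofReal_inv_of_pos (by norm_num)]
  exact ENNReal.ofReal_le_ofReal (by linarith [h.one_sub_le hs])

end StepWeights

/-! ### Weak pinning -/

section WeakPinning

theorem exp_sub_one_le_two_mul {x : ℝ} (h0 : 0 ≤ x) (h1 : x ≤ 1) : Real.exp x - 1 ≤ 2 * x := by
  have := Real.abs_exp_sub_one_le (x := x) (by rwa [abs_of_nonneg h0])
  rw [abs_of_nonneg h0] at this
  exact (le_abs_self _).trans this

theorem ofReal_sqrt_sq (n : ℕ) : ENNReal.ofReal √((n : ℝ) + 1) ^ 2 = (n : ℝ≥0∞) + 1 := by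
  rw [← ENNReal.ofReal_pow (Real.sqrt_nonneg _), Real.sq_sqrt (by positivity),
    ENNReal.ofReal_add (by positivity) (by norm_num), ENNReal.ofReal_natCast, ENNReal.ofReal_one]

/-- A summable pinning potential below the critical strength is a small perturbation of the
Green function of the killed walk, in the norm with weight `√(n + 1)`. -/
theorem sum_green_mul_le {c₀ s : ℝ} (hc₀ : 0 < c₀) (hs : 0 < s) {p : ℤ → ℝ}
    (hp : IsWalkKernel c₀ s p) {η : ℕ → ℝ≥0∞} {θ : ℝ}
    (hη : ∑' n : ℕ, η n * (n + 1) ≤ ENNReal.ofReal (θ * s)) (T x : ℕ) :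
    ∑ t ∈ Finset.range T, ∑' y : ℕ, kerPow (halfKer fun k => ENNReal.ofReal (p k)) t x y * η y *
      ENNReal.ofReal √((y : ℝ) + 1) ≤
      ENNReal.ofReal (2 * θ / c₀) * ENNReal.ofReal √((x : ℝ) + 1) := by
  set q : ℤ → ℝ≥0∞ := fun k => ENNReal.ofReal (p k) with hq
  set w : ℕ → ℝ≥0∞ := fun n => ENNReal.ofReal √((n : ℝ) + 1) with hw
  have hq1 : ENNReal.ofReal (c₀ * s / 2) ≤ q 1 := ENNReal.ofReal_le_ofReal hp.step_one
  have hq0 : q 1 ≠ 0 := (lt_of_lt_of_le (ENNReal.ofReal_pos.2 (by positivity)) hq1).ne'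
  rw [← ENNReal.mul_le_mul_iff_left hq0 ENNReal.ofReal_ne_top]
  have hG : ∀ y, (∑ t ∈ Finset.range T, kerPow (halfKer q) t x y) * q 1 ≤ w x * w y := by
    intro y
    refine (ENNReal.pow_le_pow_left_iff two_ne_zero).1 ?_
    rw [mul_pow (w x), hw, ofReal_sqrt_sq, ofReal_sqrt_sq]
    exact green_halfKer_sq_le hp.tsum_ofReal (fun k => by simp only [hp.symm]) T x y
  calc (∑ t ∈ Finset.range T, ∑' y, kerPow (halfKer q) t x y * η y * w y) * q 1
      = ∑' y, ((∑ t ∈ Finset.range T, kerPow (halfKer q) t x y) * q 1) * (η y * w y) := by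
        rw [← Summable.tsum_finsetSum fun _ _ => ENNReal.summable, ← ENNReal.tsum_mul_right]
        refine tsum_congr fun y => ?_
        simp only [Finset.sum_mul]
        exact Finset.sum_congr rfl fun t _ => by ring
    _ ≤ ∑' y, (w x * w y) * (η y * w y) :=
        ENNReal.tsum_le_tsum fun y => mul_le_mul' (hG y) le_rfl
    _ = w x * ∑' y : ℕ, η y * (y + 1) := by
        rw [← ENNReal.tsum_mul_left]
        refine tsum_congr fun y => ?_
        rw [← ofReal_sqrt_sq]
        ring
    _ ≤ w x * ENNReal.ofReal (θ * s) := by gcongr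
    _ = ENNReal.ofReal (2 * θ / c₀) * w x * ENNReal.ofReal (c₀ * s / 2) := by
        rw [mul_right_comm, ← ENNReal.ofReal_mul' (show 0 ≤ c₀ * s / 2 by positivity), mul_comm]
        congr 2
        field_simp
    _ ≤ _ := by gcongr

theorem tsum_tilt_mul_le {ε : ℕ → ℝ} (hε : ∀ j, 0 ≤ ε j) {B : ℝ} (hB : B ≤ 1)
    (hsum : Summable fun j : ℕ => ((j : ℝ) + 1) * ε j) (hle : ∑' j : ℕ, ((j : ℝ) + 1) * ε j ≤ B) :
    ∑' n : ℕ, ENNReal.ofReal (Real.exp (ε n) - 1) * (n + 1) ≤ ENNReal.ofReal (2 * B) := by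
  have h0 : ∀ j : ℕ, 0 ≤ ((j : ℝ) + 1) * ε j := fun j => mul_nonneg (by positivity) (hε j)
  have h1 : ∀ j, ε j ≤ 1 := by
    intro j
    have := (hsum.le_tsum j fun i _ => h0 i).trans (hle.trans hB)
    nlinarith [hε j, mul_nonneg (Nat.cast_nonneg (α := ℝ) j) (hε j)]
  calc ∑' n : ℕ, ENNReal.ofReal (Real.exp (ε n) - 1) * (n + 1)
      ≤ ∑' n : ℕ, ENNReal.ofReal (2 * (((n : ℝ) + 1) * ε n)) := by
        refine ENNReal.tsum_le_tsum fun n => ?_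
        have e : (n : ℝ≥0∞) + 1 = ENNReal.ofReal ((n : ℝ) + 1) := by
          rw [ENNReal.ofReal_add (by positivity) (by norm_num), ENNReal.ofReal_natCast,
            ENNReal.ofReal_one]
        rw [e, ← ENNReal.ofReal_mul' (by positivity)]
        refine ENNReal.ofReal_le_ofReal ?_
        have := exp_sub_one_le_two_mul (hε n) (h1 n)
        nlinarith [Nat.cast_nonneg (α := ℝ) n]
    _ = ENNReal.ofReal (∑' n : ℕ, 2 * (((n : ℝ) + 1) * ε n)) :=
        (ENNReal.ofReal_tsum_of_nonneg (fun n => by linarith [h0 n]) (hsum.mul_left 2)).symm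
    _ ≤ _ := by
        rw [tsum_mul_left]
        exact ENNReal.ofReal_le_ofReal (by linarith)

/-- Weak pinning: the pinned partition function is at most four times the free one. -/
theorem pinnedPartition_le_four_mul {c₀ s : ℝ} (hc₀ : 0 < c₀) (hc₀' : c₀ ≤ 1) (hs : 0 < s)
    (hs' : s ≤ 1 / 2) {p : ℤ → ℝ} (hp : IsWalkKernel c₀ s p) {ε : ℕ → ℝ} (hε : ∀ j, 0 ≤ ε j)
    (hsum : Summable fun j : ℕ => ((j : ℝ) + 1) * ε j)
    (hle : ∑' j : ℕ, ((j : ℝ) + 1) * ε j ≤ c₀ ^ 2 / 2000 * s) (L : ℕ) :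
    pinnedPartition p ε L ≤ 4 * bridgePartition p L := by
  set q : ℤ → ℝ≥0∞ := fun k => ENNReal.ofReal (p k) with hq
  set η : ℕ → ℝ≥0∞ := fun n => ENNReal.ofReal (Real.exp (ε n) - 1) with hη
  -- With this `ρ` the hypothesis `c₀ * s / 2 ≤ p 1` reads `4 * ρ ≤ p 1`, as in the heat kernel
  -- bound.
  set ρ : ℝ := c₀ * s / 8 with hρ
  set β : ℕ → ℝ≥0∞ := fun n => ENNReal.ofReal (√2 / √(1 + ρ * n)) with hβ
  have hρ0 : 0 < ρ := by positivity
  have hqs : ∀ k, q (-k) = q k := fun k => by rw [hq]; simp only [hp.symm]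
  have hq0 : 2⁻¹ ≤ q 0 := hp.half_le hs.le hs'
  have hc2 : c₀ ^ 2 ≤ 1 := pow_le_one₀ hc₀.le hc₀'
  have hB : c₀ ^ 2 / 2000 * s ≤ 1 := by nlinarith
  have hG := sum_green_mul_le hc₀ hs hp (θ := 2 * (c₀ ^ 2 / 2000)) (η := η)
    ((tsum_tilt_mul_le hε hB hsum hle).trans_eq (by ring_nf))
  rw [show 2 * (2 * (c₀ ^ 2 / 2000)) / c₀ = c₀ / 500 by field_simp; norm_num] at hG
  have hκ : ENNReal.ofReal (c₀ / 500) ≤ 8⁻¹ := by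
    rw [← ENNReal.ofReal_ofNat, ← ENNReal.ofReal_inv_of_pos (by norm_num)]
    exact ENNReal.ofReal_le_ofReal (by linarith)
  have hbound : ∀ n x y, kerPow (halfKer q) n x y ≤ β n := fun n x y =>
    (kerPow_halfKer_le q n x y).trans (kerPow_stepKer_le hp.tsum_ofReal hqs hq0 hρ0.le
      (by rw [hρ]; nlinarith)
      (ENNReal.ofReal_le_ofReal (by rw [hρ]; linarith [hp.step_one])) n x y)
  have hβ' : ∀ m n, n ≤ 2 * m → β m ≤ 2 * β n := by
    intro m n hmn
    have hmn' : (n : ℝ) ≤ 2 * m := by exact_mod_cast hmn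
    have e2 : (2 : ℝ≥0∞) = ENNReal.ofReal 2 := by simp
    simp only [hβ]
    rw [e2, ← ENNReal.ofReal_mul (by norm_num), ← mul_div_assoc]
    refine ENNReal.ofReal_le_ofReal ?_
    have h4 : √(1 + ρ * n) ≤ 2 * √(1 + ρ * m) := by
      rw [Real.sqrt_le_left (by positivity), mul_pow, Real.sq_sqrt (by positivity)]
      nlinarith [mul_le_mul_of_nonneg_left hmn' hρ0.le,
        mul_nonneg hρ0.le (Nat.cast_nonneg (α := ℝ) m)]
    rw [div_le_div_iff₀ (by positivity) (by positivity)]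
    nlinarith [Real.sqrt_nonneg 2]
  have hmain := kerPow_perturbed_le (P := halfKer q) (η := η)
    (w := fun n : ℕ => ENNReal.ofReal √((n : ℝ) + 1)) (β := β) hκ (halfKer_comm hqs)
    (fun n => by
      rw [ENNReal.one_le_ofReal]
      exact Real.one_le_sqrt.2 (by linarith [Nat.cast_nonneg (α := ℝ) n]))
    hG hbound hβ' (x := 0) (by simp) L 0
  have htilt : ∀ n, 1 + η n = ENNReal.ofReal (Real.exp (ε n)) := by
    intro n
    rw [hη, ← ENNReal.ofReal_one, ← ENNReal.ofReal_add (by norm_num)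
      (by linarith [Real.add_one_le_exp (ε n), hε n])]
    congr 1
    ring
  simp only [htilt] at hmain
  have hZ := le_kerPow_stepKer_zero hp.tsum_ofReal hqs hq0 hs.le hp.tsum_natAbs_sq.le L
  rw [bridgePartition_eq hp.nonneg]
  -- The correction is at most `3 Z`: the ratio of the upper and lower heat kernel bounds is of
  -- order `1 / c₀`, and the perturbation parameter is `c₀ / 500`.
  have hfinal : 8 * ENNReal.ofReal (c₀ / 500) * β L ≤ 3 * kerPow (stepKer q) L 0 0 := by
    refine le_trans ?_ (mul_le_mul' le_rfl hZ)
    have e3 : (3 : ℝ≥0∞) = ENNReal.ofReal 3 := by simp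
    have e8 : (8 : ℝ≥0∞) = ENNReal.ofReal 8 := by simp
    simp only [hβ]
    rw [e3, e8, ← ENNReal.ofReal_mul (by norm_num), ← ENNReal.ofReal_mul (by positivity),
      ← ENNReal.ofReal_mul (by norm_num)]
    refine ENNReal.ofReal_le_ofReal ?_
    have h5 : c₀ * √(1 + s * L) ≤ 3 * √(1 + ρ * L) := by
      refine le_of_sq_le_sq ?_ (by positivity)
      rw [mul_pow, mul_pow, Real.sq_sqrt (by positivity), Real.sq_sqrt (by positivity), hρ]
      have : 0 ≤ c₀ * (s * L) := by positivity
      nlinarith [mul_le_mul_of_nonneg_right hc₀' this]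
    have h6 : √2 ≤ 3 / 2 := by
      rw [Real.sqrt_le_left (by norm_num)]; norm_num
    rw [← mul_div_assoc (8 * (c₀ / 500)), ← mul_div_assoc 3, div_le_div_iff₀ (by positivity) (by positivity)]
    have h7 : 0 ≤ √(1 + ρ * L) := Real.sqrt_nonneg _
    calc 8 * (c₀ / 500) * √2 * √(1 + s * L) = 8 / 500 * √2 * (c₀ * √(1 + s * L)) := by ring
      _ ≤ 8 / 500 * (3 / 2) * (3 * √(1 + ρ * L)) := by gcongr
      _ ≤ _ := by nlinarith
  calc pinnedPartition p ε L ≤ _ := pinnedPartition_le hp.nonneg (hε 0) L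
    _ ≤ _ := hmain
    _ ≤ kerPow (stepKer q) L 0 0 + 3 * kerPow (stepKer q) L 0 0 := by
        refine add_le_add (kerPow_halfKer_le q L 0 0) ?_
        simpa using hfinal
    _ = _ := by ring

end WeakPinning

/-! ### Growth of kernel powers from Rayleigh quotients -/

section Growth

theorem pow_mul_le_of_log_convex {c : ℕ → ℝ≥0∞} {μ : ℝ≥0∞} (hc : ∀ n, c n ≠ ∞)
    (h1 : μ * c 0 ≤ c 1) (h2 : ∀ n, c (n + 1) ^ 2 ≤ c n * c (n + 2)) (n : ℕ) :
    μ ^ n * c 0 ≤ c n := by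
  have hstep : ∀ n, μ * c n ≤ c (n + 1) := by
    intro n
    induction n with
    | zero => exact h1
    | succ n ih =>
      rcases eq_or_ne (c n) 0 with h0 | h0
      · have h3 := h2 n
        rw [h0, zero_mul] at h3
        have h4 : c (n + 1) = 0 := by simpa using h3
        simp [h4]
      · refine (ENNReal.mul_le_mul_iff_right h0 (hc n)).1 ?_
        calc c n * (μ * c (n + 1)) = (μ * c n) * c (n + 1) := by ring
          _ ≤ c (n + 1) * c (n + 1) := by gcongr
          _ = c (n + 1) ^ 2 := (sq _).symm
          _ ≤ _ := h2 n
  induction n with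
  | zero => simp
  | succ n ih =>
    calc μ ^ (n + 1) * c 0 = μ * (μ ^ n * c 0) := by ring
      _ ≤ μ * c n := by gcongr
      _ ≤ _ := hstep n

theorem kerPow_ne_top {α : Type*} [DecidableEq α] {M : α → α → ℝ≥0∞} {S : Finset α}
    (hM : ∀ x y, M x y ≠ ∞) (hS : ∀ x y, x ∉ S → M x y = 0) (n : ℕ) (x y : α) :
    kerPow M n x y ≠ ∞ := by
  induction n generalizing y with
  | zero => rw [kerPow_zero]; split_ifs <;> simp
  | succ n ih =>
    rw [kerPow_succ, tsum_eq_sum (s := S) fun z hz => by simp [hS z y hz]]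
    exact ENNReal.sum_ne_top.2 fun z _ => ENNReal.mul_ne_top (ih z) (hM z y)

/-- The Rayleigh quotient of a symmetric kernel bounds the growth of its powers from below: by
Cauchy–Schwarz the even moments `⟨f, M ^ (2n) f⟩` are log-convex. -/
theorem pow_mul_le_quadratic_kerPow {α : Type*} [DecidableEq α] {M : α → α → ℝ≥0∞}
    {S : Finset α} {f : α → ℝ≥0∞} {μ : ℝ≥0∞} (hsymm : ∀ x y, M x y = M y x)
    (hM : ∀ x y, M x y ≠ ∞) (hS : ∀ x y, x ∉ S → M x y = 0) (hf : ∀ x, f x ≠ ∞)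
    (hfS : ∀ x, x ∉ S → f x = 0)
    (h : μ * ∑' x, f x ^ 2 ≤ ∑' x, ∑' y, f x * M x y * f y) (n : ℕ) :
    (μ ^ 2) ^ n * ∑' x, f x ^ 2 ≤ ∑' x, ∑' y, f x * kerPow M (2 * n) x y * f y := by
  set B : ℕ → ℝ≥0∞ := fun k => ∑' x, ∑' y, f x * kerPow M k x y * f y with hB
  set F : ℕ → α → ℝ≥0∞ := fun k x => ∑' y, kerPow M k x y * f y with hF
  have hprod : ∀ m n, ∑' z, F m z * F n z = B (m + n) := by
    intro m n
    calc ∑' z, F m z * F n z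
        = ∑' z, ∑' x, ∑' y, (kerPow M m z x * f x) * (kerPow M n z y * f y) := by
          refine tsum_congr fun z => ?_
          rw [hF, ← ENNReal.tsum_mul_right]
          exact tsum_congr fun x => ENNReal.tsum_mul_left.symm
      _ = ∑' x, ∑' y, ∑' z, (kerPow M m z x * f x) * (kerPow M n z y * f y) := by
          rw [ENNReal.tsum_comm]
          exact tsum_congr fun x => ENNReal.tsum_comm
      _ = _ := by
          refine tsum_congr fun x => tsum_congr fun y => ?_
          rw [kerPow_add, ← ENNReal.tsum_mul_left, ← ENNReal.tsum_mul_right]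
          refine tsum_congr fun z => ?_
          rw [kerPow_comm hsymm m z x]
          ring
  have hcs : ∀ m n, B (m + n) ^ 2 ≤ B (2 * m) * B (2 * n) := by
    intro m n
    rw [← hprod, two_mul, two_mul, ← hprod, ← hprod]
    simp only [← sq]
    exact ENNReal.sq_tsum_mul_le _ _
  have hBtop : ∀ k, B k ≠ ∞ := by
    intro k
    rw [hB]
    simp only
    rw [tsum_eq_sum (s := S) fun x hx => by simp [hfS x hx]]
    refine ENNReal.sum_ne_top.2 fun x _ => ?_
    rw [tsum_eq_sum (s := S) fun y hy => by simp [hfS y hy]]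
    exact ENNReal.sum_ne_top.2 fun y _ =>
      ENNReal.mul_ne_top (ENNReal.mul_ne_top (hf x) (kerPow_ne_top hM hS k x y)) (hf y)
  have hB0 : B 0 = ∑' x, f x ^ 2 := by
    refine tsum_congr fun x => ?_
    rw [tsum_eq_single x fun y hy => by simp [kerPow_zero, hy.symm]]
    simp [kerPow_zero, sq]
  have hB1 : μ * B 0 ≤ B 1 := by
    rw [hB0]
    simpa only [hB, kerPow_one] using h
  rw [← hB0]
  refine pow_mul_le_of_log_convex (c := fun n => B (2 * n)) (fun n => hBtop _) ?_ ?_ n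
  · rcases eq_or_ne (B 0) 0 with h0 | h0
    · simp [h0]
    · refine (ENNReal.mul_le_mul_iff_right h0 (hBtop 0)).1 ?_
      calc B 0 * (μ ^ 2 * B 0) = (μ * B 0) ^ 2 := by ring
        _ ≤ B 1 ^ 2 := by gcongr
        _ ≤ _ := hcs 0 1
  · intro n
    have := hcs n (n + 2)
    rwa [show n + (n + 2) = 2 * (n + 1) by ring] at this

theorem kerPow_zero_ne_zero {M : ℕ → ℕ → ℝ≥0∞} (h0 : ∀ x, M x x ≠ 0) (h1 : ∀ x, M x (x + 1) ≠ 0)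
    (n x : ℕ) (hx : x ≤ n) : kerPow M n 0 x ≠ 0 := by
  induction n generalizing x with
  | zero => simp [kerPow_zero, Nat.le_zero.1 hx]
  | succ n ih =>
    rcases hx.eq_or_lt with rfl | h
    · refine ne_of_gt (lt_of_lt_of_le ?_ (kerPow_mul_le M n 1 0 (n + 1) n))
      rw [kerPow_one]
      exact pos_iff_ne_zero.2 (mul_ne_zero (ih n le_rfl) (h1 n))
    · refine ne_of_gt (lt_of_lt_of_le ?_ (kerPow_mul_le M n 1 0 x x))
      rw [kerPow_one]
      exact pos_iff_ne_zero.2 (mul_ne_zero (ih x (by omega)) (h0 x))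

/-- A test function on `{0, …, d}` with Rayleigh quotient `μ` forces growth at rate `μ` of the
return weights to the origin. -/
theorem exists_mul_pow_le_kerPow {M : ℕ → ℕ → ℝ≥0∞} (hsymm : ∀ x y, M x y = M y x)
    (hM : ∀ x y, M x y ≠ ∞) (h0 : ∀ x, M x x ≠ 0) (h1 : ∀ x, M x (x + 1) ≠ 0) {d : ℕ}
    {f : ℕ → ℝ≥0∞} {μ : ℝ≥0∞} (hf : ∀ x, f x ≠ ∞) (hfS : ∀ x, d < x → f x = 0)
    (hf0 : ∑' x, f x ^ 2 ≠ 0)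
    (h : μ * ∑' x, f x ^ 2 ≤ ∑' x, ∑' y, f x * M x y * f y) :
    ∃ δ : ℝ≥0∞, δ ≠ 0 ∧ ∀ n, δ * (μ ^ 2) ^ n ≤ kerPow M (2 * n + 2 * d) 0 0 := by
  set S := Finset.range (d + 1) with hS
  set MS : ℕ → ℕ → ℝ≥0∞ := fun x y => if x ∈ S ∧ y ∈ S then M x y else 0 with hMS
  have hfS' : ∀ x, x ∉ S → f x = 0 := fun x hx => hfS x (by simpa [hS] using hx)
  have hgrow := pow_mul_le_quadratic_kerPow (M := MS) (S := S) (f := f) (μ := μ)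
    (fun x y => by simp only [hMS, and_comm, hsymm x y])
    (fun x y => by simp only [hMS]; split_ifs <;> simp [hM])
    (fun x y hx => by simp [hMS, hx]) hf hfS' (by
      refine h.trans_eq (tsum_congr fun x => tsum_congr fun y => ?_)
      by_cases hx : x ∈ S
      · by_cases hy : y ∈ S
        · simp [hMS, hx, hy]
        · simp [hfS' y hy]
      · simp [hfS' x hx])
  -- The weight of joining the origin to any point of the strip in `d` steps is at least `κ`.
  set κ := S.inf fun x => kerPow M d 0 x with hκ
  have hκ0 : κ ≠ 0 := by
    rw [hκ, ← pos_iff_ne_zero, Finset.lt_inf_iff (by simp)]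
    intro x hx
    exact pos_iff_ne_zero.2 (kerPow_zero_ne_zero h0 h1 d x (by
      have := Finset.mem_range.1 hx; omega))
  have hκle : ∀ x ∈ S, κ ≤ kerPow M d 0 x := fun x hx => Finset.inf_le hx
  set C := ∑ x ∈ S, f x with hC
  have hCtop : C ≠ ∞ := ENNReal.sum_ne_top.2 fun x _ => hf x
  refine ⟨κ * κ * (∑' x, f x ^ 2) / (C * C),
    (ENNReal.div_pos (mul_ne_zero (mul_ne_zero hκ0 hκ0) hf0)
      (ENNReal.mul_ne_top hCtop hCtop)).ne', fun n => ?_⟩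
  rw [ENNReal.mul_comm_div, ← mul_div_assoc]
  refine ENNReal.div_le_of_le_mul ?_
  calc κ * κ * (∑' x, f x ^ 2) * (μ ^ 2) ^ n
      = κ * κ * ((μ ^ 2) ^ n * ∑' x, f x ^ 2) := by ring
    _ ≤ κ * κ * ∑' x, ∑' y, f x * kerPow MS (2 * n) x y * f y := by gcongr; exact hgrow n
    _ = ∑ x ∈ S, ∑ y ∈ S, f x * f y * (κ * kerPow MS (2 * n) x y * κ) := by
        rw [tsum_eq_sum (s := S) fun x hx => by simp [hfS' x hx], Finset.mul_sum]
        refine Finset.sum_congr rfl fun x _ => ?_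
        rw [tsum_eq_sum (s := S) fun y hy => by simp [hfS' y hy], Finset.mul_sum]
        exact Finset.sum_congr rfl fun y _ => by ring
    _ ≤ ∑ x ∈ S, ∑ y ∈ S, f x * f y * kerPow M (2 * n + 2 * d) 0 0 := by
        refine Finset.sum_le_sum fun x hx => Finset.sum_le_sum fun y hy => ?_
        gcongr
        calc κ * kerPow MS (2 * n) x y * κ
            ≤ kerPow M d 0 x * kerPow M (2 * n) x y * kerPow M d y 0 := by
              gcongr
              · exact hκle x hx
              · exact kerPow_mono (fun a b => by simp only [hMS]; split_ifs <;> simp) _ _ _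
              · rw [kerPow_comm hsymm]; exact hκle y hy
          _ ≤ kerPow M (d + 2 * n) 0 y * kerPow M d y 0 := by
              gcongr; exact kerPow_mul_le M d (2 * n) 0 y x
          _ ≤ kerPow M (d + 2 * n + d) 0 0 := kerPow_mul_le M _ _ _ _ _
          _ = _ := by rw [show d + 2 * n + d = 2 * n + 2 * d by ring]
    _ = kerPow M (2 * n + 2 * d) 0 0 * (C * C) := by
        simp only [hC, Finset.sum_mul, Finset.mul_sum]
        exact Finset.sum_congr rfl fun x _ => Finset.sum_congr rfl fun y _ => by ring

end Growth

/-! ### The tent function -/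

section Tent

/-- The tent function on `{0, …, d}`: it increases with slope one from the wall, then decreases
with slope one to `0` at `d + 1`. -/
def tent (d n : ℕ) : ℕ := min (n + 1) (d + 1 - n)

theorem extendZero_tent (d : ℕ) (z : ℤ) :
    extendZero (fun n => (tent d n : ℝ≥0∞)) z = ((min (z + 1) (d + 1 - z)).toNat : ℝ≥0∞) := by
  rw [extendZero]
  split_ifs with h
  · simp only [tent]
    congr 1
    omega
  · rw [show (min (z + 1) (d + 1 - z)).toNat = 0 by omega]
    simp

/-- The tent function has slope one and support of size `d + 1`. -/
theorem incrEnergy_tent_le (d : ℕ) (k : ℤ) :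
    incrEnergy (extendZero fun n => (tent d n : ℝ≥0∞)) k ≤
      2 * ((k.natAbs : ℝ≥0∞) ^ 2 * (d + 1)) := by
  set I : Finset ℤ := Finset.Icc 0 (d : ℤ) with hI
  set χ : ℤ → ℝ≥0∞ := fun z => if z ∈ I then 1 else 0 with hχ
  have hχs : ∑' z, χ z = d + 1 := by
    rw [hχ, tsum_eq_sum (s := I) fun z hz => by simp [hz], Finset.sum_ite_mem, Finset.inter_self]
    simp [hI]
  have hle : ∀ a b : ℕ, a ≤ b + k.natAbs → b ≤ a + k.natAbs →
      ((a : ℝ≥0∞) - b) ^ 2 + ((b : ℝ≥0∞) - a) ^ 2 ≤ (k.natAbs : ℝ≥0∞) ^ 2 := by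
    intro a b h1 h2
    rw [← ENNReal.natCast_sub, ← ENNReal.natCast_sub]
    have : (a - b) ^ 2 + (b - a) ^ 2 ≤ k.natAbs ^ 2 := by
      rcases le_total a b with h | h
      · rw [Nat.sub_eq_zero_of_le h, zero_pow two_ne_zero, zero_add]
        exact Nat.pow_le_pow_left (by omega) 2
      · rw [Nat.sub_eq_zero_of_le h, zero_pow two_ne_zero, add_zero]
        exact Nat.pow_le_pow_left (by omega) 2
    exact_mod_cast this
  calc incrEnergy (extendZero fun n => (tent d n : ℝ≥0∞)) k
      ≤ ∑' z, (k.natAbs : ℝ≥0∞) ^ 2 * (χ z + χ (z + k)) := by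
        refine ENNReal.tsum_le_tsum fun z => ?_
        rw [extendZero_tent, extendZero_tent]
        by_cases h : z ∈ I ∨ z + k ∈ I
        · refine (hle _ _ (by omega) (by omega)).trans (le_mul_of_one_le_right' ?_)
          rcases h with h | h
          · simp [hχ, h]
          · simp [hχ, h]
        · have h' : ¬ (0 ≤ z ∧ z ≤ d) ∧ ¬ (0 ≤ z + k ∧ z + k ≤ d) := by
            simpa [hI] using h
          rw [show (min (z + 1) ((d : ℤ) + 1 - z)).toNat = 0 by omega,
            show (min (z + k + 1) ((d : ℤ) + 1 - (z + k))).toNat = 0 by omega]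
          simp
    _ = _ := by
        rw [ENNReal.tsum_mul_left, ENNReal.tsum_add, tsum_comp_add_right_int χ k, hχs]
        ring

/-- The Dirichlet form of the tent function is at most the variance of the walk times `d + 1`. -/
theorem tsum_tent_sq_le {q : ℤ → ℝ≥0∞} (hq : ∑' k, q k = 1) (d : ℕ) :
    ∑' n, (tent d n : ℝ≥0∞) ^ 2 ≤
      ∑' x : ℕ, ∑' y : ℕ, (tent d x : ℝ≥0∞) * halfKer q x y * tent d y +
        (d + 1) * ∑' k : ℤ, (k.natAbs : ℝ≥0∞) ^ 2 * q k := by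
  set g := extendZero fun n => (tent d n : ℝ≥0∞) with hg
  have h1 : ∑' n, (tent d n : ℝ≥0∞) ^ 2 = ∑' z, g z ^ 2 := by
    rw [tsum_int_eq_tsum_nat fun z hz => by simp [hg, extendZero_of_neg _ hz]]
    simp [hg]
  rw [← tsum_extendZero_quadratic, ← hg, tsum_quadratic_eq, h1]
  calc ∑' z, g z ^ 2 = ∑' k, q k * ∑' z, g z ^ 2 := by rw [ENNReal.tsum_mul_right, hq, one_mul]
    _ = ∑' k, q k * autocorr g k + ∑' k, q k * (2⁻¹ * incrEnergy g k) := by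
        rw [← ENNReal.tsum_add]
        simp only [← mul_add, autocorr_add_half_incrEnergy]
    _ ≤ _ := by
        gcongr
        rw [← ENNReal.tsum_mul_left]
        refine ENNReal.tsum_le_tsum fun k => ?_
        calc q k * (2⁻¹ * incrEnergy g k)
            ≤ q k * (2⁻¹ * (2 * ((k.natAbs : ℝ≥0∞) ^ 2 * (d + 1)))) := by
              gcongr; exact incrEnergy_tent_le d k
          _ = q k * ((k.natAbs : ℝ≥0∞) ^ 2 * (d + 1)) := by
              rw [← mul_assoc 2⁻¹, ENNReal.inv_mul_cancel (by simp) (by simp), one_mul]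
          _ = _ := by ring

end Tent

/-! ### Strong pinning -/

section StrongPinning

theorem div_three_le_one_sub_exp_neg {x : ℝ} (h0 : 0 ≤ x) (h2 : x ≤ 2) :
    x / 3 ≤ 1 - Real.exp (-x) := by
  have h3 : Real.exp (-x) ≤ (1 + x)⁻¹ := by
    rw [Real.exp_neg]
    exact inv_anti₀ (by linarith) (by linarith [Real.add_one_le_exp x])
  have h4 : (1 + x)⁻¹ ≤ 1 - x / 3 := by
    rw [← one_div, div_le_iff₀ (by linarith)]
    nlinarith
  linarith

/-- Testing with the tent function: when the pinning potential is of order at most the variance,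
its gain beats the Dirichlet energy. -/
theorem mul_tsum_tent_le {c₀ s : ℝ} (hs : 0 < s) (hs' : s ≤ 1 / 2) {p : ℤ → ℝ}
    (hp : IsWalkKernel c₀ s p) {ε : ℕ → ℝ} (hε : ∀ j, 0 ≤ ε j) {d : ℕ}
    (hε' : ∀ j ≤ d / 2, ε j ≤ 4 * s)
    (h : 6 * s ≤ 1 / ((d : ℝ) + 1) * ∑ j ∈ Finset.range (d / 2 + 1), ((j : ℝ) + 1) ^ 2 * ε j) :
    ENNReal.ofReal (1 + s / ((d : ℝ) + 1) ^ 2) *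
        ∑' n, (tent d n : ℝ≥0∞) ^ 2 * ENNReal.ofReal (Real.exp (-ε n)) ≤
      ∑' x : ℕ, ∑' y : ℕ, (tent d x : ℝ≥0∞) * halfKer (fun k => ENNReal.ofReal (p k)) x y *
        tent d y := by
  have htent0 : ∀ n, n ∉ Finset.range (d + 1) → tent d n = 0 := by
    intro n hn
    rw [Finset.mem_range] at hn
    simp only [tent]; omega
  have hA : ∑' n, (tent d n : ℝ≥0∞) ^ 2 =
      ENNReal.ofReal (∑ n ∈ Finset.range (d + 1), (tent d n : ℝ) ^ 2) := by
    rw [tsum_eq_sum (s := Finset.range (d + 1)) fun n hn => by simp [htent0 n hn],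
      ENNReal.ofReal_sum_of_nonneg fun _ _ => by positivity]
    refine Finset.sum_congr rfl fun n _ => ?_
    rw [ENNReal.ofReal_pow (by positivity), ENNReal.ofReal_natCast]
  have hA' : ∑' n, (tent d n : ℝ≥0∞) ^ 2 * ENNReal.ofReal (Real.exp (-ε n)) =
      ENNReal.ofReal (∑ n ∈ Finset.range (d + 1), (tent d n : ℝ) ^ 2 * Real.exp (-ε n)) := by
    rw [tsum_eq_sum (s := Finset.range (d + 1)) fun n hn => by simp [htent0 n hn],
      ENNReal.ofReal_sum_of_nonneg fun _ _ => by positivity]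
    refine Finset.sum_congr rfl fun n _ => ?_
    rw [ENNReal.ofReal_mul (by positivity), ENNReal.ofReal_pow (by positivity),
      ENNReal.ofReal_natCast]
  set A := ∑ n ∈ Finset.range (d + 1), (tent d n : ℝ) ^ 2 with hAdef
  set A' := ∑ n ∈ Finset.range (d + 1), (tent d n : ℝ) ^ 2 * Real.exp (-ε n) with hA'def
  have hd : (0 : ℝ) < (d : ℝ) + 1 := by positivity
  have hgain : 2 * s * (d + 1) ≤ A - A' := by
    calc 2 * s * (d + 1) ≤ ∑ j ∈ Finset.range (d / 2 + 1), ((j : ℝ) + 1) ^ 2 * (ε j / 3) := by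
          rw [one_div, inv_mul_eq_div, le_div_iff₀ hd] at h
          simp only [mul_div_assoc']
          rw [← Finset.sum_div]
          linarith
      _ ≤ ∑ j ∈ Finset.range (d / 2 + 1), (tent d j : ℝ) ^ 2 * (1 - Real.exp (-ε j)) := by
          refine Finset.sum_le_sum fun j hj => ?_
          have hj' : j ≤ d / 2 := by have := Finset.mem_range.1 hj; omega
          have e : tent d j = j + 1 := by simp only [tent]; omega
          rw [e, Nat.cast_succ]
          gcongr
          exact div_three_le_one_sub_exp_neg (hε j) (by linarith [hε' j hj'])
      _ ≤ ∑ j ∈ Finset.range (d + 1), (tent d j : ℝ) ^ 2 * (1 - Real.exp (-ε j)) := by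
          refine Finset.sum_le_sum_of_subset_of_nonneg ?_ fun j _ _ => ?_
          · exact Finset.range_subset_range.2 (by omega)
          · have := Real.exp_le_one_iff.2 (neg_nonpos.2 (hε j))
            exact mul_nonneg (sq_nonneg _) (by linarith)
      _ = A - A' := by
          rw [hAdef, hA'def, ← Finset.sum_sub_distrib]
          exact Finset.sum_congr rfl fun j _ => by ring
  have hA'le : A' ≤ (d + 1) * ((d : ℝ) + 1) ^ 2 := by
    calc A' ≤ ∑ n ∈ Finset.range (d + 1), ((d : ℝ) + 1) ^ 2 := by
          refine Finset.sum_le_sum fun n _ => ?_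
          have h1 := Real.exp_le_one_iff.2 (neg_nonpos.2 (hε n))
          have h2 : (tent d n : ℝ) ≤ (d : ℝ) + 1 := by
            have : tent d n ≤ d + 1 := by simp only [tent]; omega
            exact_mod_cast this
          calc (tent d n : ℝ) ^ 2 * Real.exp (-ε n) ≤ (tent d n : ℝ) ^ 2 * 1 := by gcongr
            _ ≤ _ := by rw [mul_one]; gcongr
      _ = _ := by simp
  have hE := tsum_tent_sq_le hp.tsum_ofReal d
  rw [hp.tsum_natAbs_sq, hA] at hE
  have e : ((d : ℝ≥0∞) + 1) * ENNReal.ofReal s = ENNReal.ofReal ((d + 1) * s) := by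
    rw [ENNReal.ofReal_mul (by positivity), ENNReal.ofReal_add (by positivity) (by norm_num),
      ENNReal.ofReal_natCast, ENNReal.ofReal_one]
  rw [e, ← tsub_le_iff_right, ← ENNReal.ofReal_sub _ (by positivity)] at hE
  rw [hA', ← ENNReal.ofReal_mul (by positivity)]
  refine (ENNReal.ofReal_le_ofReal ?_).trans hE
  have h5 : s / ((d : ℝ) + 1) ^ 2 * A' ≤ s * (d + 1) := by
    calc s / ((d : ℝ) + 1) ^ 2 * A' ≤ s / ((d : ℝ) + 1) ^ 2 * ((d + 1) * ((d : ℝ) + 1) ^ 2) := by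
          gcongr
      _ = _ := by field_simp
  linarith

/-- The symmetric kernel `e^{ε/2} P⁺ e^{ε/2}`, conjugate to the tilted killed kernel `e^ε P⁺`. -/
noncomputable def symmTilt (ε : ℕ → ℝ) (p : ℤ → ℝ) (x y : ℕ) : ℝ≥0∞ :=
  ENNReal.ofReal (Real.exp (ε x / 2)) * halfKer (fun k => ENNReal.ofReal (p k)) x y *
    ENNReal.ofReal (Real.exp (ε y / 2))

theorem ofReal_exp_half_mul_self (x : ℝ) :
    ENNReal.ofReal (Real.exp (x / 2)) * ENNReal.ofReal (Real.exp (x / 2)) =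
      ENNReal.ofReal (Real.exp x) := by
  rw [← ENNReal.ofReal_mul (Real.exp_pos _).le, ← Real.exp_add, add_halves]

theorem kerPow_symmTilt_zero (ε : ℕ → ℝ) (p : ℤ → ℝ) (n : ℕ) :
    kerPow (symmTilt ε p) n 0 0 = kerPow (fun x y => ENNReal.ofReal (Real.exp (ε x)) *
        halfKer (fun k => ENNReal.ofReal (p k)) x y) n 0 0 := by
  have h := kerPow_conj (r := fun x => ENNReal.ofReal (Real.exp (ε x / 2)))
    (halfKer fun k => ENNReal.ofReal (p k)) n 0 0
  simp only [ofReal_exp_half_mul_self] at h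
  rw [mul_comm] at h
  exact (ENNReal.mul_left_inj (ENNReal.ofReal_pos.2 (Real.exp_pos _)).ne'
    ENNReal.ofReal_ne_top).1 h

/-- The growth criterion holds with rate `s / (2 (d + 1)²)`: either a single site of the lower
half of the strip is attractive enough to bind the walk, or the tent function is a test function
with large Rayleigh quotient. -/
theorem exists_testFunction {c₀ s : ℝ} (hs : 0 < s) (hs' : s ≤ 1 / 2) {p : ℤ → ℝ}
    (hp : IsWalkKernel c₀ s p) {ε : ℕ → ℝ} (hε : ∀ j, 0 ≤ ε j) {d : ℕ}
    (h : 6 * s ≤ 1 / ((d : ℝ) + 1) * ∑ j ∈ Finset.range (d / 2 + 1), ((j : ℝ) + 1) ^ 2 * ε j) :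
    ∃ f : ℕ → ℝ≥0∞, (∀ x, f x ≠ ∞) ∧ (∀ x, d < x → f x = 0) ∧ ∑' x, f x ^ 2 ≠ 0 ∧
      ENNReal.ofReal (Real.exp (s / (2 * ((d : ℝ) + 1) ^ 2))) * ∑' x, f x ^ 2 ≤
        ∑' x, ∑' y, f x * symmTilt ε p x y * f y := by
  have hd1 : (1 : ℝ) ≤ ((d : ℝ) + 1) ^ 2 := one_le_pow₀ (by linarith [Nat.cast_nonneg (α := ℝ) d])
  have hrate : s / (2 * ((d : ℝ) + 1) ^ 2) ≤ s / 2 := by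
    gcongr
    linarith
  by_cases hbig : ∃ j ≤ d / 2, 4 * s < ε j
  · obtain ⟨j, hj, hjs⟩ := hbig
    have hf : ∑' x : ℕ, (if x = j then 1 else 0 : ℝ≥0∞) ^ 2 = 1 := by
      rw [tsum_eq_single j fun x hx => by simp [hx]]
      simp
    refine ⟨fun x => if x = j then 1 else 0, fun x => by dsimp only; split_ifs <;> simp,
      fun x hx => if_neg (by omega), by simp, ?_⟩
    rw [hf, mul_one, tsum_eq_single j fun x hx => by simp [hx],
      tsum_eq_single j fun x hx => by simp [hx]]
    simp only [if_true, one_mul, mul_one, symmTilt, halfKer, sub_self]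
    rw [mul_right_comm, ofReal_exp_half_mul_self, ← ENNReal.ofReal_mul (Real.exp_pos _).le]
    refine ENNReal.ofReal_le_ofReal ?_
    have h1 := hp.one_sub_le hs.le
    calc Real.exp (s / (2 * ((d : ℝ) + 1) ^ 2)) ≤ Real.exp (2 * s) := by
          gcongr; linarith
      _ ≤ Real.exp (2 * s) * (Real.exp (2 * s) * (1 - s)) := by
          refine le_mul_of_one_le_right (Real.exp_pos _).le ?_
          calc (1 : ℝ) ≤ (2 * s + 1) * (1 - s) := by nlinarith
            _ ≤ _ := by
                gcongr
                · linarith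
                · exact Real.add_one_le_exp _
      _ = Real.exp (4 * s) * (1 - s) := by
          rw [← mul_assoc, ← Real.exp_add]; ring_nf
      _ ≤ Real.exp (ε j) * p 0 := by gcongr; linarith
  · push Not at hbig
    have hr : ∀ x : ℕ, ENNReal.ofReal (Real.exp (-(ε x / 2))) *
        ENNReal.ofReal (Real.exp (ε x / 2)) = 1 := by
      intro x
      rw [← ENNReal.ofReal_mul (Real.exp_pos _).le, ← Real.exp_add]
      simp
    have hsq : ∀ x : ℕ, ((tent d x : ℝ≥0∞) * ENNReal.ofReal (Real.exp (-(ε x / 2)))) ^ 2 =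
        (tent d x : ℝ≥0∞) ^ 2 * ENNReal.ofReal (Real.exp (-ε x)) := by
      intro x
      rw [mul_pow, sq (ENNReal.ofReal _), ← neg_div, ofReal_exp_half_mul_self]
    refine ⟨fun x => tent d x * ENNReal.ofReal (Real.exp (-(ε x / 2))),
      fun x => ENNReal.mul_ne_top (ENNReal.natCast_ne_top _) ENNReal.ofReal_ne_top,
      fun x hx => ?_, ?_, ?_⟩
    · have : tent d x = 0 := by simp only [tent]; omega
      simp [this]
    · refine ne_of_gt (lt_of_lt_of_le ?_ (ENNReal.le_tsum 0))
      have : tent d 0 ≠ 0 := by simp only [tent]; omega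
      refine pos_iff_ne_zero.2 (pow_ne_zero _ (mul_ne_zero (by exact_mod_cast this) ?_))
      exact (ENNReal.ofReal_pos.2 (Real.exp_pos _)).ne'
    · simp only [hsq]
      calc _ ≤ ENNReal.ofReal (1 + s / ((d : ℝ) + 1) ^ 2) *
            ∑' n, (tent d n : ℝ≥0∞) ^ 2 * ENNReal.ofReal (Real.exp (-ε n)) := by
            gcongr
            have h0 : 0 ≤ s / (2 * ((d : ℝ) + 1) ^ 2) := by positivity
            have := exp_sub_one_le_two_mul h0 (by linarith)
            have e : 2 * (s / (2 * ((d : ℝ) + 1) ^ 2)) = s / ((d : ℝ) + 1) ^ 2 := by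
              field_simp
            linarith
        _ ≤ _ := mul_tsum_tent_le hs hs' hp hε hbig h
        _ = _ := by
            refine tsum_congr fun x => tsum_congr fun y => ?_
            rw [symmTilt]
            calc _ = (tent d x : ℝ≥0∞) * halfKer (fun k => ENNReal.ofReal (p k)) x y *
                  tent d y * (1 * 1) := by ring
              _ = (tent d x : ℝ≥0∞) * halfKer (fun k => ENNReal.ofReal (p k)) x y * tent d y *
                  (ENNReal.ofReal (Real.exp (-(ε x / 2))) * ENNReal.ofReal (Real.exp (ε x / 2)) *
                  (ENNReal.ofReal (Real.exp (-(ε y / 2))) *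
                    ENNReal.ofReal (Real.exp (ε y / 2)))) := by rw [hr x, hr y]
              _ = _ := by ring

/-- Strong pinning: the expectation of the tilt grows exponentially. -/
theorem eventually_exp_le_nonnegExpect {c₀ s : ℝ} (hc₀ : 0 < c₀) (hs : 0 < s) (hs' : s ≤ 1 / 2)
    {p : ℤ → ℝ} (hp : IsWalkKernel c₀ s p) {ε : ℕ → ℝ} (hε : ∀ j, 0 ≤ ε j) {d : ℕ}
    (h : 6 * s ≤ 1 / ((d : ℝ) + 1) * ∑ j ∈ Finset.range (d / 2 + 1), ((j : ℝ) + 1) ^ 2 * ε j) :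
    ∀ᶠ L : ℕ in Filter.atTop,
      ENNReal.ofReal (Real.exp (1 / 4 * s * (L : ℝ) / ((d : ℝ) + 1) ^ 2)) ≤
        nonnegExpect p L (fun γ => ENNReal.ofReal (Real.exp (pinPotential ε γ))) := by
  set ω : ℝ := s / (4 * ((d : ℝ) + 1) ^ 2) with hω
  have hω0 : 0 < ω := by positivity
  have hrpos : ∀ x : ℝ, ENNReal.ofReal (Real.exp x) ≠ 0 := fun x =>
    (ENNReal.ofReal_pos.2 (Real.exp_pos _)).ne'
  obtain ⟨f, hf, hfS, hf0, hray⟩ := exists_testFunction hs hs' hp hε h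
  rw [show s / (2 * ((d : ℝ) + 1) ^ 2) = 2 * ω by
    rw [hω]; field_simp; norm_num] at hray
  have hhalf := hp.half_le hs.le hs'
  have hM0 : ∀ x, 2⁻¹ ≤ symmTilt ε p x x := by
    intro x
    rw [symmTilt, mul_right_comm, ofReal_exp_half_mul_self]
    calc (2⁻¹ : ℝ≥0∞) = 1 * 2⁻¹ := (one_mul _).symm
      _ ≤ _ := by
        gcongr
        · rw [ENNReal.one_le_ofReal]; exact Real.one_le_exp (hε x)
        · simpa [halfKer] using hhalf
  obtain ⟨δ, hδ0, hδ⟩ := exists_mul_pow_le_kerPow (M := symmTilt ε p) (d := d)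
    (fun x y => by
      simp only [symmTilt]
      rw [halfKer_comm (fun k => by simp only [hp.symm]) x y]
      ring)
    (fun x y => ENNReal.mul_ne_top (ENNReal.mul_ne_top ENNReal.ofReal_ne_top
      ENNReal.ofReal_ne_top) ENNReal.ofReal_ne_top)
    (fun x => (lt_of_lt_of_le (by simp) (hM0 x)).ne')
    (fun x => by
      refine mul_ne_zero (mul_ne_zero (hrpos _) ?_) (hrpos _)
      simp only [halfKer, Nat.cast_succ, add_sub_cancel_left]
      exact (ENNReal.ofReal_pos.2 (lt_of_lt_of_le (by positivity) hp.step_one)).ne')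
    hf hfS hf0 hray
  obtain ⟨δ', hδ'0, hδ'⟩ : ∃ δ' : ℝ, 0 < δ' ∧ ENNReal.ofReal δ' ≤ δ := by
    refine ⟨(min δ 1).toReal, ENNReal.toReal_pos ?_ ?_, ?_⟩
    · exact (lt_min (pos_iff_ne_zero.2 hδ0) one_pos).ne'
    · exact ne_top_of_le_ne_top ENNReal.one_ne_top (min_le_right _ _)
    · rw [ENNReal.ofReal_toReal (ne_top_of_le_ne_top ENNReal.one_ne_top (min_le_right _ _))]
      exact min_le_left _ _
  have hpow : ∀ n : ℕ, (ENNReal.ofReal (Real.exp (2 * ω)) ^ 2) ^ n =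
      ENNReal.ofReal (Real.exp (2 * ω * (2 * n))) := by
    intro n
    rw [← pow_mul, ← ENNReal.ofReal_pow (Real.exp_pos _).le, ← Real.exp_nat_mul]
    push_cast
    ring_nf
  -- The return weights grow at rate `2 * ω`, twice the rate that is claimed. By laziness odd
  -- times cost a factor `2`.
  have hgrow : ∀ L : ℕ, 2 * d ≤ L →
      ENNReal.ofReal (δ' / 2 * Real.exp (2 * ω * (L - 2 * d - 1))) ≤
        kerPow (symmTilt ε p) L 0 0 := by
    have hev : ∀ n : ℕ, ENNReal.ofReal (δ' * Real.exp (2 * ω * (2 * n))) ≤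
        kerPow (symmTilt ε p) (2 * n + 2 * d) 0 0 := by
      intro n
      refine le_trans ?_ (hδ n)
      rw [hpow, ENNReal.ofReal_mul hδ'0.le]
      gcongr
    intro L hL
    obtain ⟨n, hn | hn⟩ := Nat.even_or_odd' (L - 2 * d)
    · obtain rfl : L = 2 * n + 2 * d := by omega
      refine le_trans (ENNReal.ofReal_le_ofReal ?_) (hev n)
      gcongr
      · linarith
      · push_cast; linarith
    · obtain rfl : L = 2 * n + 2 * d + 1 := by omega
      refine le_trans ?_ (kerPow_mul_le _ (2 * n + 2 * d) 1 0 0 0)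
      rw [kerPow_one]
      calc ENNReal.ofReal (δ' / 2 * Real.exp (2 * ω * (↑(2 * n + 2 * d + 1) - 2 * d - 1)))
          = ENNReal.ofReal (δ' * Real.exp (2 * ω * (2 * n))) * 2⁻¹ := by
            rw [← ENNReal.ofReal_ofNat, ← ENNReal.ofReal_inv_of_pos (by norm_num),
              ← ENNReal.ofReal_mul (by positivity)]
            congr 1
            push_cast
            ring_nf
        _ ≤ _ := mul_le_mul' (hev n) (hM0 0)
  have hlim : Filter.Tendsto (fun L : ℕ => Real.exp (ω * L)) Filter.atTop Filter.atTop :=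
    Real.tendsto_exp_atTop.comp (tendsto_natCast_atTop_atTop.const_mul_atTop hω0)
  -- The surplus `exp (ω L)` absorbs the factor `exp (ε 0)` of the starting point and the prefactor.
  filter_upwards [hlim.eventually_ge_atTop
      (Real.exp (ε 0) / (δ' / 2 * Real.exp (2 * ω * (- 2 * d - 1)))),
    Filter.eventually_ge_atTop (2 * d), Filter.eventually_ge_atTop 1] with L hL1 hL2 hL3
  obtain ⟨L, rfl⟩ : ∃ L', L = L' + 1 := ⟨L - 1, by omega⟩
  have hZ1 : nonnegPartition p (L + 1) ≤ 1 := by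
    refine (nonnegPartition_le_bridgePartition p (L + 1)).trans ?_
    rw [bridgePartition_eq hp.nonneg, ← tsum_kerPow_eq_one (tsum_stepKer hp.tsum_ofReal) (L + 1) 0]
    exact ENNReal.le_tsum 0
  have hpin : pinnedPartition p ε (L + 1) ≤
      nonnegExpect p (L + 1) (fun γ => ENNReal.ofReal (Real.exp (pinPotential ε γ))) := by
    refine ENNReal.tsum_le_tsum fun γ => ?_
    gcongr
    rw [nonnegLaw, div_eq_mul_inv]
    exact le_mul_of_one_le_right' (ENNReal.one_le_inv.2 hZ1)
  refine le_trans ?_ hpin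
  refine (ENNReal.mul_le_mul_iff_right (hrpos (ε 0)) ENNReal.ofReal_ne_top).1 ?_
  rw [pinnedPartition_succ hp.nonneg, ← kerPow_symmTilt_zero]
  refine le_trans ?_ (hgrow (L + 1) hL2)
  rw [← ENNReal.ofReal_mul (Real.exp_pos _).le]
  refine ENNReal.ofReal_le_ofReal ?_
  rw [div_le_iff₀ (by positivity)] at hL1
  calc Real.exp (ε 0) * Real.exp (1 / 4 * s * ↑(L + 1) / ((d : ℝ) + 1) ^ 2)
      = Real.exp (ε 0) * Real.exp (ω * ↑(L + 1)) := by
        congr 2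
        rw [hω]
        field_simp
    _ ≤ (Real.exp (ω * ↑(L + 1)) * (δ' / 2 * Real.exp (2 * ω * (-2 * d - 1)))) *
          Real.exp (ω * ↑(L + 1)) := by gcongr
    _ = δ' / 2 * (Real.exp (ω * ↑(L + 1)) * Real.exp (ω * ↑(L + 1)) *
          Real.exp (2 * ω * (-2 * d - 1))) := by ring
    _ = _ := by
        rw [← Real.exp_add, ← Real.exp_add]
        ring_nf

end StrongPinning

theorem theorem2 (c₀ : ℝ) (hc₀ : 0 < c₀) (hc₀' : c₀ ≤ 1) :
    ∃ a b c : ℝ, 0 < a ∧ 0 < b ∧ 0 < c ∧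
      ∀ s : ℝ, 0 < s → s ≤ 1 / 2 →
      ∀ p : ℤ → ℝ, IsWalkKernel c₀ s p →
      ∀ ε : ℕ → ℝ, (∀ j, 0 ≤ ε j) →
        (∀ d : ℕ,
          a * s ≤ 1 / ((d : ℝ) + 1) * ∑ j ∈ Finset.range (d / 2 + 1), ((j : ℝ) + 1) ^ 2 * ε j →
          ∀ᶠ L : ℕ in Filter.atTop,
            ENNReal.ofReal (Real.exp (c * s * (L : ℝ) / ((d : ℝ) + 1) ^ 2)) ≤
              nonnegExpect p L (fun γ => ENNReal.ofReal (Real.exp (pinPotential ε γ)))) ∧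
        ((Summable fun j : ℕ => ((j : ℝ) + 1) * ε j) →
          ∑' j : ℕ, ((j : ℝ) + 1) * ε j ≤ b * s →
          ∀ L : ℕ, pinnedPartition p ε L ≤ 4 * bridgePartition p L) :=
  ⟨6, c₀ ^ 2 / 2000, 1 / 4, by norm_num, by positivity, by norm_num,
    fun _ hs hs' _ hp _ hε =>
      ⟨fun _ hd => eventually_exp_le_nonnegExpect hc₀ hs hs' hp hε hd,
        fun hsum hle => pinnedPartition_le_four_mul hc₀ hc₀' hs hs' hp hε hsum hle⟩⟩
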